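/- Let $k$ be a field, $s\ge 0$, $T(V)=k\langle x_1,\dots,x_s\rangle$ the tensor algebra on $V=\mathrm{span}_k\{x_1,\dots,x_s\}$, $M$ its monoid of monomials (words), $I\subset T(V)$ a two-sided ideal generated by finitely many monomials of degree at least $2$, and $A=T(V)/I$ with projection $\pi$. For $m\in M\setminus I$ let $\mathfrak A_m$ be the set of monomials $w\notin I$ such that $w\otimes m\in I$ and no proper right factor $w'$ of $w$ satisfies $w'\otimes m\in I$. Put $\mathfrak G_0=\{x_1,\dots,x_s\}$, $\mathfrak G_{i+1}=\bigcup_{w\in\mathfrak G_i}\mathfrak A_w$, $\mathfrak G=\bigcup_i\mathfrak G_i$. Let $\Gamma(A)$ be the directed graph with vertex set $\mathfrak G$ and edges $m_1\to m_2$ for $m_2\in\mathfrak A_{m_1}$. A walk of length $n$ is a sequence $w_0\cdots w_n$ of vertices with edges $w_i\to w_{i+1}$; it is *anchored* if $w_0\in\mathfrak G_0$. Two walks $p_0\cdots p_n$ and $q_0\cdots q_m$ are *equivalent* if $n=m$ and $p_n\otimes\cdots\otimes p_0=q_n\otimes\cdots\otimes q_0$; a walk is *admissible* if it is equivalent to an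 anchored walk. Let $P_\bullet$ be the projective resolution of the trivial left $A$-module $k=A/A_+$ in which $P_0=Ae_\emptyset$ and $P_{j+1}$ is free on symbols $e_w$, $w$ an anchored walk of length $j$, with $d(e_{w_0\cdots w_j})=\pi(w_j)e_{w_0\cdots w_{j-1}}$ (and $d(e_{w_0})=\pi(w_0)e_\emptyset$). For an anchored walk $w$ of length $n$ let $\varepsilon_w\in E^{n+1}(A)=\mathrm{Ext}^{n+1}_A(k,k)$ be the class of the cocycle dual to $e_w$. Let $E(A)=\bigoplus_i E^i(A)$ with the Yoneda product. A class $\alpha\in E^i(A)$, $i>0$, is *decomposable* if it lies in the subalgebra of $E(A)$ generated by $\bigoplus_{j<i}E^j(A)$, and *indecomposable* otherwise. (1) If $w$ is an anchored walk of length $n$, then $\varepsilon_w$ is decomposable if and only if there exist an admissible walk $p=p_0\cdots p_m$ and an index $0\le i<n$ such that $w=w_0\cdots w_i\,p_0\cdots p_m$. (2) The relations of $E(A)$ are monomials and binomials: the indecomposable classes $\varepsilon_w$ ($w$ an anchored walk) generate $E(A)$ as a $k$-algebra, none of them lies in the subalgebra generated by the others, and the kernel of the resulting surjection from the free $k$-algebra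 on these walks onto $E(A)$ is generated, as a two-sided ideal, by a set of monomials (words) and binomials ($c\,u+d\,v$ with words $u\ne v$ and $c,d\in k\setminus\{0\}$). -/

import Mathlib

open CategoryTheory CategoryTheory.Abelian

namespace MonomialYoneda
section ExtAlgebra
universe t w v u

variable {C : Type u} [Category.{v} C] [Abelian C] [HasExt.{w} C]

theorem mk_comp_eq {X : C} {a b c c' : ℕ} (α : Ext.{w} X X a) (β : Ext.{w} X X b)
    (h : a + b = c) (h' : a + b = c') :
    GradedMonoid.mk (A := fun n : ℕ => Ext.{w} X X n) c (α.comp β h) =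
      GradedMonoid.mk c' (α.comp β h') := by
  subst h; subst h'; rfl

noncomputable instance extGOne (X : C) : GradedMonoid.GOne (fun n : ℕ => Ext.{w} X X n) where
  one := Ext.mk₀ (𝟙 X)

/-- The Yoneda product `α ⋆ β`: first `β`, then `α`. -/
noncomputable instance extGMul (X : C) : GradedMonoid.GMul (fun n : ℕ => Ext.{w} X X n) where
  mul {i j} α β := β.comp α (Nat.add_comm j i)

noncomputable instance extGRing (X : C) : DirectSum.GRing (fun n : ℕ => Ext.{w} X X n) where
  mul_zero _ := Ext.zero_comp _ _ _ _ (Nat.add_comm _ _)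
  zero_mul _ := Ext.comp_zero _ _ _ _ (Nat.add_comm _ _)
  mul_add _ _ _ := Ext.add_comp _ _ _ _
  add_mul _ _ _ := Ext.comp_add _ _ _ _
  one_mul := by
    rintro ⟨i, α⟩
    exact (mk_comp_eq α (Ext.mk₀ (𝟙 X)) _ (add_zero i)).trans (by rw [Ext.comp_mk₀_id]; rfl)
  mul_one := by
    rintro ⟨i, α⟩
    exact (mk_comp_eq (Ext.mk₀ (𝟙 X)) α _ (zero_add i)).trans (by rw [Ext.mk₀_id_comp]; rfl)
  mul_assoc := by
    rintro ⟨i, α⟩ ⟨j, β⟩ ⟨l, γ⟩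
    refine (mk_comp_eq γ (β.comp α (Nat.add_comm j i)) _
      (show l + (i + j) = l + j + i by omega)).trans ?_
    refine Eq.trans ?_ (mk_comp_eq (γ.comp β (Nat.add_comm l j)) α _
      (show j + l + i = l + j + i by omega)).symm
    congr 1
    exact (Ext.comp_assoc γ β α (Nat.add_comm l j) (Nat.add_comm j i) (by omega)).symm
  natCast n := n • Ext.mk₀ (𝟙 X)
  natCast_zero := zero_smul _ _
  natCast_succ n := succ_nsmul _ n
  intCast n := n • Ext.mk₀ (𝟙 X)
  intCast_ofNat n := natCast_zsmul _ n
  intCast_negSucc_ofNat n := negSucc_zsmul _ n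

noncomputable instance extGAlgebra (k : Type t) [CommRing k] [Linear k C] (X : C) :
    DirectSum.GAlgebra k (fun n : ℕ => Ext.{w} X X n) where
  toFun := (LinearMap.toSpanSingleton k (Ext.{w} X X 0) (Ext.mk₀ (𝟙 X))).toAddMonoidHom
  map_one := one_smul k _
  map_mul r s := by
    refine Eq.trans ?_ (mk_comp_eq (s • Ext.mk₀ (𝟙 X)) (r • Ext.mk₀ (𝟙 X)) _ (add_zero 0)).symm
    congr 1
    show (r * s) • (Ext.mk₀ (𝟙 X) : Ext.{w} X X 0) = _
    rw [Ext.comp_smul, Ext.comp_mk₀_id, smul_smul]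
  commutes := by
    rintro r ⟨i, α⟩
    refine (mk_comp_eq α (r • Ext.mk₀ (𝟙 X)) _ (add_zero i)).trans ?_
    refine Eq.trans ?_ (mk_comp_eq (r • Ext.mk₀ (𝟙 X)) α _ (zero_add i)).symm
    congr 1
    rw [Ext.comp_smul, Ext.smul_comp, Ext.comp_mk₀_id, Ext.mk₀_id_comp]
  smul_def := by
    rintro r ⟨i, α⟩
    refine Eq.trans ?_ (mk_comp_eq α (r • Ext.mk₀ (𝟙 X)) _ (add_zero i)).symm
    show GradedMonoid.mk i (r • α) = _
    rw [Ext.comp_smul, Ext.comp_mk₀_id]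

/-- The algebra `⨁_n Ext^n(X, X)` with the Yoneda product. -/
abbrev ExtAlgebra (X : C) : Type w := DirectSum ℕ (fun n : ℕ => Ext.{w} X X n)

/-- A class `α` of degree `i` is decomposable if it lies in the subalgebra generated by the
classes of degree `< i`. -/
def IsDecomposable (k : Type t) [CommRing k] [Linear k C] {X : C} {i : ℕ} (α : Ext.{w} X X i) :
    Prop :=
  DirectSum.of (fun n : ℕ => Ext.{w} X X n) i α ∈
    Algebra.adjoin k {x : ExtAlgebra.{w} X | ∃ j < i, ∃ β : Ext.{w} X X j,
      x = DirectSum.of (fun n : ℕ => Ext.{w} X X n) j β}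

end ExtAlgebra

universe u

/-- A monomial in a free algebra: a word with coefficient `1`. -/
def IsMonomial {k : Type u} [Field k] {G : Type*} (f : MonoidAlgebra k (FreeMonoid G)) : Prop :=
  ∃ a : FreeMonoid G, f = MonoidAlgebra.of k (FreeMonoid G) a

/-- A binomial in a free algebra: a linear combination of two distinct words with nonzero
coefficients. -/
def IsBinomial {k : Type u} [Field k] {G : Type*} (f : MonoidAlgebra k (FreeMonoid G)) : Prop :=
  ∃ a b : FreeMonoid G, a ≠ b ∧ ∃ c d : k, c ≠ 0 ∧ d ≠ 0 ∧
    f = c • MonoidAlgebra.of k (FreeMonoid G) a + d • MonoidAlgebra.of k (FreeMonoid G) b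

/-- The monoid of monomials in `x_1, …, x_s` (words, multiplied by concatenation). -/
abbrev Mon (s : ℕ) : Type := FreeMonoid (Fin s)

/-- The tensor algebra `T(V)` on `V = span {x_1, …, x_s}`: its basis is the monoid of monomials. -/
abbrev TensorAlg (k : Type u) [Field k] (s : ℕ) : Type u := MonoidAlgebra k (Mon s)

/-- A finite set of monomials of degree at least `2`, the generators of a monomial ideal. -/
structure MonomialRelations (s : ℕ) where
  /-- the generators -/
  gens : Finset (Mon s)
  /-- they have degree at least `2` -/
  two_le_length : ∀ r ∈ gens, 2 ≤ FreeMonoid.length r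

namespace MonomialRelations

variable {s : ℕ} (R : MonomialRelations s) (k : Type u) [Field k]

/-- The ideal `I` of `T(V)` generated by the given monomials. -/
noncomputable def ideal : TwoSidedIdeal (TensorAlg k s) :=
  TwoSidedIdeal.span ((MonoidAlgebra.of k (Mon s)) '' (R.gens : Set (Mon s)))

/-- The monomial algebra `A = T(V)/I`. -/
abbrev Alg : Type u := (R.ideal k).ringCon.Quotient

/-- The natural surjection `π : T(V) → A`. -/
noncomputable def proj : TensorAlg k s →ₐ[k] R.Alg k := (R.ideal k).ringCon.mkₐ (α := k)

/-- The monomial `m` lies in `I`. -/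
def InIdeal (m : Mon s) : Prop := MonoidAlgebra.of k (Mon s) m ∈ R.ideal k

/-- The set `𝔄_m` of monomials `w ∉ I` with `w ⊗ m ∈ I` and `L(w, m) = w`, that is, no proper right
factor `w'` of `w = w'' ⊗ w'` satisfies `w' ⊗ m ∈ I`. -/
def leftAnn (m : Mon s) : Set (Mon s) :=
  {w | ¬ R.InIdeal k w ∧ R.InIdeal k (w * m) ∧
    ∀ w'' w' : Mon s, w = w'' * w' → R.InIdeal k (w' * m) → w' = w}

/-- `𝔊_0 = {x_1, …, x_s}`. -/
def vert₀ (s : ℕ) : Set (Mon s) := Set.range FreeMonoid.of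

/-- `𝔊_{i+1}` is the union of the `𝔄_w`, `w ∈ 𝔊_i`. -/
def vertLevel : ℕ → Set (Mon s)
  | 0 => vert₀ s
  | i + 1 => ⋃ w ∈ vertLevel i, R.leftAnn k w

/-- The vertex set `𝔊` of the CPS graph. -/
def vert : Set (Mon s) := ⋃ i, R.vertLevel k i

/-- The edges `m₁ → m₂` of the CPS graph `Γ(A)`. -/
def Edge (m₁ m₂ : Mon s) : Prop :=
  m₁ ∈ R.vert k ∧ m₂ ∈ R.vert k ∧ m₂ ∈ R.leftAnn k m₁

/-- `l = [w_0, …, w_n]` is a (finite) walk of length `n` in `Γ(A)`. -/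
def IsWalk (l : List (Mon s)) : Prop :=
  l ≠ [] ∧ (∀ v ∈ l, v ∈ R.vert k) ∧ l.IsChain (R.Edge k)

/-- A walk is anchored if its initial vertex lies in `𝔊_0`. -/
def IsAnchored (l : List (Mon s)) : Prop :=
  R.IsWalk k l ∧ ∃ x ∈ vert₀ s, l.head? = some x

/-- Equivalence of walks: same length, and `p_n ⊗ ⋯ ⊗ p_0 = q_n ⊗ ⋯ ⊗ q_0` as monomials. -/
def WalkEquiv (p q : List (Mon s)) : Prop :=
  p.length = q.length ∧ p.reverse.prod = q.reverse.prod

/-- A walk is admissible if it is equivalent to an anchored walk. -/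
def IsAdmissible (p : List (Mon s)) : Prop :=
  R.IsWalk k p ∧ ∃ q, R.IsAnchored k q ∧ WalkEquiv p q

/-- The possible next vertices of an anchored walk (or of the empty walk). -/
def Next (l : List (Mon s)) (m : Mon s) : Prop :=
  (l = [] ∧ m ∈ vert₀ s) ∨ ∃ v, l.getLast? = some v ∧ m ∈ R.leftAnn k v

variable {k} in
theorem InIdeal.mul_left {m : Mon s} (h : R.InIdeal k m) (a : Mon s) : R.InIdeal k (a * m) := by
  unfold InIdeal at *
  rw [map_mul]
  exact TwoSidedIdeal.mul_mem_left _ _ _ h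

/-- A monomial occurs in an element of `I` only if it has one of the generators as a factor. -/
theorem exists_factor_of_mem_ideal {x : TensorAlg k s} (hx : x ∈ R.ideal k) (m : Mon s)
    (hm : x.coeff m ≠ 0) : ∃ r ∈ R.gens, ∃ u v, m = u * r * v := by
  classical
  let J : TwoSidedIdeal (TensorAlg k s) := TwoSidedIdeal.mk'
    {x | ∀ m, x.coeff m ≠ 0 → ∃ r ∈ R.gens, ∃ u v, m = u * r * v}
    (by intro m hm; simp at hm)
    (by
      intro x y hx hy m hm
      by_cases h : x.coeff m = 0
      · exact hy m (by simpa [h] using hm)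
      · exact hx m h)
    (by intro x hx m hm; exact hx m (by simpa using hm))
    (by
      intro x y hy m hm
      have := MonoidAlgebra.support_coeff_mul_subset x y (Finsupp.mem_support_iff.2 hm)
      obtain ⟨a, ha, b, hb, rfl⟩ := Finset.mem_mul.1 this
      obtain ⟨r, hr, u, v, rfl⟩ := hy b (Finsupp.mem_support_iff.1 hb)
      exact ⟨r, hr, a * u, v, by simp only [mul_assoc]⟩)
    (by
      intro x y hx m hm
      have := MonoidAlgebra.support_coeff_mul_subset x y (Finsupp.mem_support_iff.2 hm)
      obtain ⟨a, ha, b, hb, rfl⟩ := Finset.mem_mul.1 this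
      obtain ⟨r, hr, u, v, rfl⟩ := hx a (Finsupp.mem_support_iff.1 ha)
      exact ⟨r, hr, u, v * b, by simp only [mul_assoc]⟩)
  have hle : R.ideal k ≤ J := by
    refine TwoSidedIdeal.span_le.2 ?_
    rintro _ ⟨r, hr, rfl⟩
    refine (TwoSidedIdeal.mem_mk' _ _ _ _ _ _ _).2 ?_
    intro m hm
    have : m = r := by
      by_contra hne
      simp [MonoidAlgebra.of_apply, Ne.symm hne] at hm
    exact ⟨r, hr, 1, 1, by simp [this]⟩
  exact (TwoSidedIdeal.mem_mk' _ _ _ _ _ _ _).1 (hle hx) m hm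

theorem inIdeal_of_factor {r : Mon s} (hr : r ∈ R.gens) (u v : Mon s) :
    R.InIdeal k (u * r * v) := by
  unfold InIdeal
  rw [map_mul, map_mul]
  exact TwoSidedIdeal.mul_mem_right _ _ _ (TwoSidedIdeal.mul_mem_left _ _ _
    (TwoSidedIdeal.subset_span ⟨r, hr, rfl⟩))

theorem inIdeal_of_mem_ideal {x : TensorAlg k s} (hx : x ∈ R.ideal k) (m : Mon s)
    (hm : x.coeff m ≠ 0) : R.InIdeal k m := by
  obtain ⟨r, hr, u, v, rfl⟩ := R.exists_factor_of_mem_ideal k hx m hm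
  exact R.inIdeal_of_factor k hr u v

theorem InIdeal.two_le {m : Mon s} (h : R.InIdeal k m) : 2 ≤ FreeMonoid.length m := by
  obtain ⟨r, hr, u, v, rfl⟩ := R.exists_factor_of_mem_ideal k h m (by simp [MonoidAlgebra.of_apply])
  have := R.two_le_length r hr
  simp only [FreeMonoid.length_mul]
  omega

theorem length_of_mem_vert₀ {m : Mon s} (h : m ∈ vert₀ s) : FreeMonoid.length m = 1 := by
  obtain ⟨x, rfl⟩ := h
  exact FreeMonoid.length_of x

theorem not_inIdeal_of_mem_vert {m : Mon s} (h : m ∈ R.vert k) : ¬ R.InIdeal k m := by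
  obtain ⟨i, hi⟩ := Set.mem_iUnion.1 h
  cases i with
  | zero =>
    intro hm
    have := InIdeal.two_le R k hm
    have := length_of_mem_vert₀ hi
    omega
  | succ i =>
    obtain ⟨w, -, hw⟩ := Set.mem_iUnion₂.1 hi
    exact hw.1

theorem vert₀_subset : vert₀ s ⊆ R.vert k := fun _ h => Set.mem_iUnion.2 ⟨0, h⟩

theorem mem_vert_of_leftAnn {v m : Mon s} (hv : v ∈ R.vert k) (hm : m ∈ R.leftAnn k v) :
    m ∈ R.vert k := by
  obtain ⟨i, hi⟩ := Set.mem_iUnion.1 hv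
  exact Set.mem_iUnion.2 ⟨i + 1, Set.mem_iUnion₂.2 ⟨v, hi, hm⟩⟩

/-- The empty list, or an anchored walk: the index set of the basis of the resolution. -/
def IsIndex (l : List (Mon s)) : Prop := l = [] ∨ R.IsAnchored k l

theorem isIndex_append_iff (l : List (Mon s)) (m : Mon s) :
    R.IsIndex k (l ++ [m]) ↔ R.IsIndex k l ∧ R.Next k l m := by
  rcases List.eq_nil_or_concat l with rfl | ⟨l', v, rfl⟩
  · simp only [IsIndex, IsAnchored, IsWalk, Next]
    constructor
    · intro h; simp at h; simp [h]
    · intro h; simp at h; simp [h, R.vert₀_subset k h]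
  · have hne : l' ++ [v] ≠ [] := by simp
    have hhd : (l' ++ [v] ++ [m]).head? = (l' ++ [v]).head? := by
      cases l' <;> simp
    simp only [IsIndex, IsAnchored, IsWalk, Next, List.concat_eq_append, hhd]
    simp only [List.isChain_append]
    simp [Edge]
    constructor
    · rintro ⟨⟨h1, h2, h3⟩, h4⟩
      refine ⟨⟨⟨fun x hx => h1 x (by tauto), h2⟩, h4⟩, h3.2.2⟩
    · rintro ⟨⟨⟨h1, h2⟩, h4⟩, h3⟩
      have hv : v ∈ R.vert k := h1 v (Or.inr rfl)
      have hm := R.mem_vert_of_leftAnn k hv h3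
      refine ⟨⟨?_, h2, hv, hm, h3⟩, h4⟩
      rintro x (hx | rfl | rfl)
      · exact h1 x (Or.inl hx)
      · exact hv
      · exact hm

theorem proj_eq_zero_iff (x : TensorAlg k s) : R.proj k x = 0 ↔ x ∈ R.ideal k := by
  rw [TwoSidedIdeal.mem_iff]
  exact RingCon.eq _

theorem proj_of_eq_zero {m : Mon s} (h : R.InIdeal k m) :
    R.proj k (MonoidAlgebra.of k _ m) = 0 := (R.proj_eq_zero_iff k _).2 h

theorem proj_surjective : Function.Surjective (R.proj k) := RingCon.mkₐ_surjective (α := k) _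

theorem ne_one_of_next {l : List (Mon s)} {m : Mon s} (hl : R.IsIndex k l) (h : R.Next k l m) :
    m ≠ 1 := by
  rintro rfl
  rcases h with ⟨-, h⟩ | ⟨v, hv, h⟩
  · have := length_of_mem_vert₀ h
    simp at this
  · rcases hl with rfl | hl
    · simp at hv
    · exact R.not_inIdeal_of_mem_vert k (hl.1.2.1 v (List.mem_of_getLast? hv)) (by simpa using h.2.1)

theorem eq_of_suffix {a b c d : Mon s} (h : a * b = c * d) :
    (∃ t, b = t * d) ∨ ∃ t, d = t * b := by
  have h' : FreeMonoid.toList a ++ FreeMonoid.toList b =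
    FreeMonoid.toList c ++ FreeMonoid.toList d := h
  rcases List.append_eq_append_iff.1 h' with ⟨t, -, ht⟩ | ⟨t, -, ht⟩
  · exact Or.inl ⟨FreeMonoid.ofList t, ht⟩
  · exact Or.inr ⟨FreeMonoid.ofList t, ht⟩

theorem next_unique {l : List (Mon s)} {a b c d : Mon s} (h : a * b = c * d)
    (hb : R.Next k l b) (hd : R.Next k l d) : a = c ∧ b = d := by
  have hbd : b = d := by
    rcases hb with ⟨rfl, hb⟩ | ⟨v, hv, hb⟩
    · rcases hd with ⟨-, hd⟩ | ⟨v, hv, -⟩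
      · have h1 := length_of_mem_vert₀ hb
        have h2 := length_of_mem_vert₀ hd
        rcases eq_of_suffix h with ⟨t, ht⟩ | ⟨t, ht⟩
        · have := congrArg FreeMonoid.length ht
          rw [FreeMonoid.length_mul] at this
          have : t = 1 := FreeMonoid.length_eq_zero.1 (by omega)
          simpa [this] using ht
        · have := congrArg FreeMonoid.length ht
          rw [FreeMonoid.length_mul] at this
          have : t = 1 := FreeMonoid.length_eq_zero.1 (by omega)
          simpa [this] using ht.symm
      · simp at hv
    · rcases hd with ⟨rfl, -⟩ | ⟨v', hv', hd⟩
      · simp at hv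
      · obtain rfl : v = v' := by rw [hv] at hv'; exact Option.some.inj hv'
        rcases eq_of_suffix h with ⟨t, ht⟩ | ⟨t, ht⟩
        · exact (hb.2.2 t d ht hd.2.1).symm
        · exact hd.2.2 t b ht hb.2.1
  subst hbd
  exact ⟨mul_right_cancel h, rfl⟩

theorem exists_next {v m : Mon s} (hm : ¬ R.InIdeal k m) (h : R.InIdeal k (m * v)) :
    ∃ m'' m' : Mon s, m = m'' * m' ∧ m' ∈ R.leftAnn k v := by
  classical
  have hex : ∃ n, ∃ m'' m' : Mon s, m = m'' * m' ∧ R.InIdeal k (m' * v) ∧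
      FreeMonoid.length m' = n := ⟨_, 1, m, by simp, h, rfl⟩
  obtain ⟨m'', m', rfl, h1, h2⟩ := Nat.find_spec hex
  refine ⟨m'', m', rfl, fun h' => hm (h'.mul_left R m''), h1, ?_⟩
  intro a b hab hb
  have hle := Nat.find_min' hex ⟨m'' * a, b, by rw [hab, mul_assoc], hb, rfl⟩
  have hl := congrArg FreeMonoid.length hab
  rw [FreeMonoid.length_mul] at hl
  have : a = 1 := FreeMonoid.length_eq_zero.1 (by omega)
  simpa [this] using hab.symm

/-- The basis of the `j`-th term `P_j` of the resolution: the anchored walks of length `j - 1`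
(lists of `j` vertices), and the empty walk for `j = 0`. -/
abbrev Idx (j : ℕ) : Type := {l : List (Mon s) // l.length = j ∧ R.IsIndex k l}

theorem Idx.ne_nil {j : ℕ} (w : R.Idx k (j + 1)) : w.1 ≠ [] := by
  intro h; have := w.2.1; simp [h] at this

variable {R k} in
/-- The last vertex of a walk. -/
def Idx.last {j : ℕ} (w : R.Idx k (j + 1)) : Mon s := w.1.getLast (Idx.ne_nil R k w)

theorem Idx.dropLast_append {j : ℕ} (w : R.Idx k (j + 1)) : w.1.dropLast ++ [w.last] = w.1 :=
  List.dropLast_append_getLast _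

variable {R k} in
/-- The walk with the last vertex removed. -/
def Idx.init {j : ℕ} (w : R.Idx k (j + 1)) : R.Idx k j :=
  ⟨w.1.dropLast, by rw [List.length_dropLast, w.2.1]; rfl,
    ((R.isIndex_append_iff k w.1.dropLast w.last).1
      ((Idx.dropLast_append R k w).symm ▸ w.2.2)).1⟩

theorem Idx.next {j : ℕ} (w : R.Idx k (j + 1)) : R.Next k w.init.1 w.last :=
  ((R.isIndex_append_iff k w.1.dropLast w.last).1
    ((Idx.dropLast_append R k w).symm ▸ w.2.2)).2

variable {R k} in
/-- The walk with a vertex appended. -/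
def Idx.snoc {j : ℕ} (w : R.Idx k j) (m : Mon s) (h : R.Next k w.1 m) : R.Idx k (j + 1) :=
  ⟨w.1 ++ [m], by simp [w.2.1], (R.isIndex_append_iff k _ _).2 ⟨w.2.2, h⟩⟩

theorem Idx.init_snoc {j : ℕ} (w : R.Idx k j) (m : Mon s) (h : R.Next k w.1 m) :
    (w.snoc m h).init = w := Subtype.ext (by simp [Idx.init, Idx.snoc])

theorem Idx.last_snoc {j : ℕ} (w : R.Idx k j) (m : Mon s) (h : R.Next k w.1 m) :
    (w.snoc m h).last = m := by simp [Idx.last, Idx.snoc]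

theorem Idx.snoc_init {j : ℕ} (w : R.Idx k (j + 1)) :
    w.init.snoc w.last (Idx.next R k w) = w :=
  Subtype.ext (Idx.dropLast_append R k w)

/-- The differential: `d(e_w) = π(w_n) e_{w_0 ⋯ w_{n-1}}` for `w = w_0 ⋯ w_n`. -/
noncomputable def diff (j : ℕ) : (R.Idx k (j + 1) →₀ R.Alg k) →ₗ[R.Alg k] (R.Idx k j →₀ R.Alg k) :=
  Finsupp.linearCombination (R.Alg k) fun w =>
    Finsupp.single w.init (R.proj k (MonoidAlgebra.of k _ w.last))

theorem diff_single {j : ℕ} (w : R.Idx k (j + 1)) (a : R.Alg k) :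
    R.diff k j (Finsupp.single w a) =
      Finsupp.single w.init (a * R.proj k (MonoidAlgebra.of k _ w.last)) := by
  simp [diff, Finsupp.linearCombination_single, Finsupp.smul_single]

theorem last_init {j : ℕ} (w : R.Idx k (j + 1 + 1)) :
    w.last ∈ R.leftAnn k w.init.last := by
  rcases Idx.next R k w with ⟨h, -⟩ | ⟨v, hv, h⟩
  · exact absurd h (Idx.ne_nil R k w.init)
  · rw [List.getLast?_eq_some_getLast (Idx.ne_nil R k w.init)] at hv
    cases Option.some.inj hv
    exact h

theorem diff_diff (j : ℕ) : R.diff k j ∘ₗ R.diff k (j + 1) = 0 := by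
  refine Finsupp.lhom_ext fun w a => ?_
  rw [LinearMap.comp_apply, diff_single, diff_single, mul_assoc, ← map_mul, ← map_mul,
    R.proj_of_eq_zero k (R.last_init k w).2.1, mul_zero, Finsupp.single_zero, LinearMap.zero_apply]

/-- The augmentation `T(V) → k`, `x_i ↦ 0`. -/
noncomputable def augT : TensorAlg k s →ₐ[k] k :=
  MonoidAlgebra.lift k k (Mon s) (FreeMonoid.lift fun _ => 0)

theorem augT_of {m : Mon s} (hm : m ≠ 1) : augT k (MonoidAlgebra.of k _ m) = 0 := by
  induction m using FreeMonoid.casesOn with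
  | one => exact absurd rfl hm
  | of_mul x xs => simp [augT]

theorem augT_eq_zero {x : TensorAlg k s} (hx : x ∈ R.ideal k) : augT k x = 0 := by
  have hle : R.ideal k ≤ TwoSidedIdeal.ker (augT k) := by
    refine TwoSidedIdeal.span_le.2 ?_
    rintro _ ⟨r, hr, rfl⟩
    refine (TwoSidedIdeal.mem_ker _).2 (augT_of k ?_)
    rintro rfl
    have := R.two_le_length 1 hr
    simp at this
  exact (TwoSidedIdeal.mem_ker _).1 (hle hx)

/-- The augmentation `A → k`, with kernel `A_+`. -/
noncomputable def aug : R.Alg k →ₐ[k] k :=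
  RingCon.liftₐ (R.ideal k).ringCon (augT k) (fun x y h => by
    have := R.augT_eq_zero k ((TwoSidedIdeal.rel_iff _ _ _).1 h)
    rwa [map_sub, sub_eq_zero] at this)

theorem aug_proj (x : TensorAlg k s) : R.aug k (R.proj k x) = augT k x := rfl

theorem aug_proj_of {m : Mon s} (hm : m ≠ 1) : R.aug k (R.proj k (MonoidAlgebra.of k _ m)) = 0 :=
  augT_of k hm

open Classical in
/-- A contracting homotopy on monomials. -/
noncomputable def htpyMon {j : ℕ} (w : R.Idx k j) (m : Mon s) : R.Idx k (j + 1) →₀ R.Alg k :=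
  if h : ¬ R.InIdeal k m ∧ ∃ p : Mon s × Mon s, m = p.1 * p.2 ∧ R.Next k w.1 p.2 then
    Finsupp.single (w.snoc h.2.choose.2 h.2.choose_spec.2)
      (R.proj k (MonoidAlgebra.of k _ h.2.choose.1))
  else 0

theorem htpyMon_mul {j : ℕ} (w : R.Idx k j) (a b : Mon s) (hm : ¬ R.InIdeal k (a * b))
    (hb : R.Next k w.1 b) :
    R.htpyMon k w (a * b) =
      Finsupp.single (w.snoc b hb) (R.proj k (MonoidAlgebra.of k _ a)) := by
  have h : ¬ R.InIdeal k (a * b) ∧ ∃ p : Mon s × Mon s, a * b = p.1 * p.2 ∧ R.Next k w.1 p.2 :=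
    ⟨hm, (a, b), rfl, hb⟩
  rw [htpyMon, dif_pos h]
  obtain ⟨h1, h2⟩ := R.next_unique k h.2.choose_spec.1 hb h.2.choose_spec.2
  congr 1
  · congr 1; exact h2.symm
  · rw [← h1]

theorem htpyMon_of_mem {j : ℕ} (w : R.Idx k j) {m : Mon s} (hm : R.InIdeal k m) :
    R.htpyMon k w m = 0 := dif_neg fun h => h.1 hm

theorem htpyMon_of_not {j : ℕ} (w : R.Idx k j) {m : Mon s}
    (hm : ¬ ∃ p : Mon s × Mon s, m = p.1 * p.2 ∧ R.Next k w.1 p.2) :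
    R.htpyMon k w m = 0 := dif_neg fun h => hm h.2

/-- The linear extension of `htpyMon`. -/
noncomputable def htpyT {j : ℕ} (w : R.Idx k j) :
    TensorAlg k s →ₗ[k] (R.Idx k (j + 1) →₀ R.Alg k) :=
  (Finsupp.linearCombination k (R.htpyMon k w)) ∘ₗ
    (MonoidAlgebra.coeffLinearEquiv k).toLinearMap

theorem htpyT_of {j : ℕ} (w : R.Idx k j) (m : Mon s) :
    R.htpyT k w (MonoidAlgebra.of k _ m) = R.htpyMon k w m := by
  simp [htpyT, MonoidAlgebra.of_apply, Finsupp.linearCombination_single]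

theorem htpyT_eq_zero {j : ℕ} (w : R.Idx k j) {x : TensorAlg k s} (hx : x ∈ R.ideal k) :
    R.htpyT k w x = 0 := by
  show Finsupp.linearCombination k (R.htpyMon k w) x.coeff = 0
  rw [Finsupp.linearCombination_apply, Finsupp.sum]
  refine Finset.sum_eq_zero fun m hm => ?_
  rw [R.htpyMon_of_mem k w (R.inIdeal_of_mem_ideal k hx m (Finsupp.mem_support_iff.1 hm)),
    smul_zero]

/-- The contracting homotopy on a summand. -/
noncomputable def htpyA {j : ℕ} (w : R.Idx k j) :
    R.Alg k →+ (R.Idx k (j + 1) →₀ R.Alg k) :=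
  AddCon.lift (R.ideal k).ringCon.toAddCon (R.htpyT k w).toAddMonoidHom (fun x y h => by
    have := R.htpyT_eq_zero k w ((TwoSidedIdeal.rel_iff _ _ _).1 h)
    rwa [map_sub, sub_eq_zero] at this)

theorem htpyA_proj {j : ℕ} (w : R.Idx k j) (x : TensorAlg k s) :
    R.htpyA k w (R.proj k x) = R.htpyT k w x := rfl

/-- The contracting homotopy. -/
noncomputable def htpy (j : ℕ) :
    (R.Idx k j →₀ R.Alg k) →+ (R.Idx k (j + 1) →₀ R.Alg k) :=
  Finsupp.liftAddHom fun w => R.htpyA k w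

theorem htpy_single {j : ℕ} (w : R.Idx k j) (x : TensorAlg k s) :
    R.htpy k j (Finsupp.single w (R.proj k x)) = R.htpyT k w x := by
  rw [htpy, Finsupp.liftAddHom_apply_single, htpyA_proj]

theorem diff_single_proj {j : ℕ} (w : R.Idx k (j + 1)) (x : TensorAlg k s) :
    R.diff k j (Finsupp.single w (R.proj k x)) =
      Finsupp.single w.init (R.proj k (x * MonoidAlgebra.of k _ w.last)) := by
  rw [diff_single, map_mul]

theorem diff_htpyMon_of_next {j : ℕ} (w : R.Idx k j) (a b : Mon s) (hb : R.Next k w.1 b)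
    (hm : ¬ R.InIdeal k (a * b)) :
    R.diff k j (R.htpyMon k w (a * b)) =
      Finsupp.single w (R.proj k (MonoidAlgebra.of k _ (a * b))) := by
  rw [R.htpyMon_mul k w a b hm hb, diff_single_proj, Idx.init_snoc, Idx.last_snoc, ← map_mul]

theorem homotopy_mon {j : ℕ} (w : R.Idx k (j + 1)) (m : Mon s) :
    R.diff k (j + 1) (R.htpyMon k w m) + R.htpyMon k w.init (m * w.last) =
      Finsupp.single w (R.proj k (MonoidAlgebra.of k _ m)) := by
  by_cases hm : R.InIdeal k m
  · have h2 : R.InIdeal k (m * w.last) := by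
      unfold InIdeal at *
      rw [map_mul]
      exact TwoSidedIdeal.mul_mem_right _ _ _ hm
    rw [R.htpyMon_of_mem k w hm, R.htpyMon_of_mem k _ h2, R.proj_of_eq_zero k hm]
    simp
  · have hlast : w.1.getLast? = some w.last :=
      List.getLast?_eq_some_getLast (Idx.ne_nil R k w)
    by_cases h : ∃ p : Mon s × Mon s, m = p.1 * p.2 ∧ R.Next k w.1 p.2
    · obtain ⟨⟨a, b⟩, rfl, hb⟩ := h
      rw [R.diff_htpyMon_of_next k w a b hb hm]
      have h2 : R.InIdeal k (a * b * w.last) := by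
        rcases hb with ⟨hn, -⟩ | ⟨v, hv, hb⟩
        · exact absurd hn (Idx.ne_nil R k w)
        · obtain rfl : w.last = v := Option.some.inj (hlast.symm.trans hv)
          rw [mul_assoc]
          exact hb.2.1.mul_left R a
      rw [R.htpyMon_of_mem k _ h2, add_zero]
    · have h2 : ¬ R.InIdeal k (m * w.last) := by
        intro h2
        obtain ⟨a, b, rfl, hb⟩ := R.exists_next k hm h2
        exact h ⟨(a, b), rfl, Or.inr ⟨_, hlast, hb⟩⟩
      rw [R.htpyMon_of_not k w h, R.htpyMon_mul k _ m w.last h2 (Idx.next R k w), Idx.snoc_init]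
      simp

theorem homotopy_succ {j : ℕ} (x : R.Idx k (j + 1) →₀ R.Alg k) :
    R.diff k (j + 1) (R.htpy k (j + 1) x) + R.htpy k j (R.diff k j x) = x := by
  induction x using Finsupp.induction_linear with
  | zero => simp
  | add f g hf hg => 
    simp only [map_add]
    nth_rw 3 [← hf, ← hg]
    abel
  | single w a =>
    obtain ⟨y, rfl⟩ := R.proj_surjective k a
    rw [diff_single_proj, htpy_single, htpy_single]
    induction y using MonoidAlgebra.induction_linear with
    | zero => simp
    | add f g hf hg =>
      simp only [map_add, add_mul, Finsupp.single_add]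
      rw [← hf, ← hg]
      abel
    | single m c =>
      have hc : MonoidAlgebra.single m c = c • MonoidAlgebra.of k (Mon s) m := by
        simp [MonoidAlgebra.of_apply]
      rw [hc, smul_mul_assoc, ← map_mul, (R.htpyT k w).map_smul, (R.htpyT k w.init).map_smul,
        map_smul (R.proj k), htpyT_of, htpyT_of, LinearMap.map_smul_of_tower, ← smul_add, homotopy_mon, Finsupp.smul_single]

/-- The empty walk. -/
def Idx.nil : R.Idx k 0 := ⟨[], rfl, Or.inl rfl⟩

theorem Idx.eq_nil (w : R.Idx k 0) : w = Idx.nil R k :=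
  Subtype.ext (List.length_eq_zero_iff.1 w.2.1)

/-- The augmentation `P_0 = A e_∅ → k` (with values in `k`). -/
noncomputable def augP (x : R.Idx k 0 →₀ R.Alg k) : k := R.aug k (x (Idx.nil R k))

theorem homotopy_zero (x : R.Idx k 0 →₀ R.Alg k) :
    R.diff k 0 (R.htpy k 0 x) + 
      Finsupp.single (Idx.nil R k) (algebraMap k (R.Alg k) (R.augP k x)) = x := by
  induction x using Finsupp.induction_linear with
  | zero => simp [augP]
  | add f g hf hg => 
    simp only [map_add, augP, Finsupp.add_apply, Finsupp.single_add] at *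
    nth_rw 3 [← hf, ← hg]
    abel
  | single w a =>
    obtain rfl := Idx.eq_nil R k w
    obtain ⟨y, rfl⟩ := R.proj_surjective k a
    rw [augP, Finsupp.single_eq_same, aug_proj, htpy_single]
    induction y using MonoidAlgebra.induction_linear with
    | zero => simp
    | add f g hf hg =>
      simp only [map_add, Finsupp.single_add]
      rw [← hf, ← hg]
      abel
    | single m c =>
      have hc : MonoidAlgebra.single m c = c • MonoidAlgebra.of k (Mon s) m := by
        simp [MonoidAlgebra.of_apply]
      rw [hc, (R.htpyT k _).map_smul, map_smul (R.proj k), map_smul (augT k), htpyT_of,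
        LinearMap.map_smul_of_tower, smul_eq_mul,
        map_mul, ← Algebra.smul_def, ← Finsupp.smul_single, ← Finsupp.smul_single, ← smul_add]
      congr 1
      by_cases hm1 : m = 1
      · subst hm1
        rw [R.htpyMon_of_not]
        · simp only [map_one, map_zero, zero_add]
        · rintro ⟨⟨a, b⟩, h1, h2⟩
          have := congrArg FreeMonoid.length h1
          have hb : b = 1 := by
            rw [FreeMonoid.length_mul] at this
            exact FreeMonoid.length_eq_zero.1 (by simp at this; omega)
          exact R.ne_one_of_next k (Or.inl rfl) h2 hb
      · rw [augT_of k hm1, map_zero, Finsupp.single_zero, add_zero]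
        by_cases hm : R.InIdeal k m
        · rw [R.htpyMon_of_mem k _ hm, R.proj_of_eq_zero k hm]; simp
        · obtain ⟨l, x, hl⟩ := (List.eq_nil_or_concat (FreeMonoid.toList m)).resolve_left hm1
          have hl' : m = FreeMonoid.ofList l * FreeMonoid.of x := by
            apply FreeMonoid.toList.injective
            rw [hl]; simp
          subst hl'
          exact R.diff_htpyMon_of_next k _ _ _ (Or.inl ⟨rfl, ⟨x, rfl⟩⟩) hm

theorem exact_succ (j : ℕ) (x : R.Idx k (j + 1) →₀ R.Alg k) (hx : R.diff k j x = 0) :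
    ∃ y, R.diff k (j + 1) y = x :=
  ⟨R.htpy k (j + 1) x, by
    have := R.homotopy_succ k x
    rwa [hx, map_zero, add_zero] at this⟩

theorem exact_zero (x : R.Idx k 0 →₀ R.Alg k) (hx : R.augP k x = 0) :
    ∃ y, R.diff k 0 y = x :=
  ⟨R.htpy k 0 x, by
    have := R.homotopy_zero k x
    rwa [hx, map_zero, Finsupp.single_zero, add_zero] at this⟩

set_option linter.unusedVariables false in
/-- The field `k`, to be regarded as an `A`-module through the augmentation. -/
@[nolint unusedArguments]
def TrivCarrier (R : MonomialRelations s) (k : Type u) [Field k] : Type u := k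

noncomputable instance : AddCommGroup (R.TrivCarrier k) := inferInstanceAs (AddCommGroup k)

/-- `A` acts on `k` by `a • c = aug(a) c`. -/
noncomputable instance : Module (R.Alg k) (R.TrivCarrier k) :=
  Module.compHom k (R.aug k).toRingHom

/-- The trivial left `A`-module `k = A/A_+`. -/
noncomputable abbrev triv : ModuleCat.{u} (R.Alg k) := ModuleCat.of (R.Alg k) (R.TrivCarrier k)

/-- The complex `P_•` of free left `A`-modules: `P_0 = A e_∅`, and `P_{j+1}` is free on the `e_w`
for the anchored walks `w` of length `j`. -/
noncomputable def cpx : ChainComplex (ModuleCat.{u} (R.Alg k)) ℕ :=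
  ChainComplex.of (fun j => ModuleCat.of (R.Alg k) (R.Idx k j →₀ R.Alg k))
    (fun j => ModuleCat.ofHom (R.diff k j))
    (fun j => by
      rw [← ModuleCat.ofHom_comp, diff_diff, ModuleCat.ofHom_zero])

theorem cpx_d (j : ℕ) : (R.cpx k).d (j + 1) j = ModuleCat.ofHom (R.diff k j) :=
  (ChainComplex.of_d (X := fun j => ModuleCat.of (R.Alg k) (R.Idx k j →₀ R.Alg k))
    (d := fun j => ModuleCat.ofHom (R.diff k j)) j :)

instance (j : ℕ) : Projective ((R.cpx k).X j) :=
  inferInstanceAs (Projective (ModuleCat.of (R.Alg k) (R.Idx k j →₀ R.Alg k)))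

/-- The linear map `P_j → k` that is dual to the basis vector `e_w`. -/
noncomputable def dualVec {j : ℕ} (w : R.Idx k j) :
    (R.Idx k j →₀ R.Alg k) →ₗ[R.Alg k] R.TrivCarrier k where
  toFun x := (R.aug k (x w) : k)
  map_add' x y := map_add (R.aug k) (x w) (y w)
  map_smul' a x := by
    show R.aug k (a * x w) = R.aug k a * R.aug k (x w)
    rw [map_mul]

theorem dualVec_diff {j : ℕ} (w : R.Idx k j) : R.dualVec k w ∘ₗ R.diff k j = 0 := by
  refine Finsupp.lhom_ext fun v a => ?_
  rw [LinearMap.comp_apply, diff_single]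
  show R.aug k (Finsupp.single v.init (a * _) w) = 0
  by_cases h : v.init = w
  · rw [h, Finsupp.single_eq_same, map_mul,
      R.aug_proj_of k (R.ne_one_of_next k v.init.2.2 (Idx.next R k v)), mul_zero]
  · rw [Finsupp.single_eq_of_ne' h, map_zero]

/-- The augmentation `P_• → k`. -/
noncomputable def augHom : R.cpx k ⟶ (ChainComplex.single₀ _).obj (R.triv k) :=
  ((R.cpx k).toSingle₀Equiv _).symm ⟨ModuleCat.ofHom (R.dualVec k (Idx.nil R k)), by
    rw [cpx_d]
    erw [← ModuleCat.ofHom_comp]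
    rw [dualVec_diff]
    rfl⟩

/-- In degree `0` the augmentation is `e_∅ ↦ 1`. -/
theorem augHom_f_zero :
    (R.augHom k).f 0 = ModuleCat.ofHom (R.dualVec k (Idx.nil R k)) := by
  exact ChainComplex.toSingle₀Equiv_symm_apply_f_zero _ _

theorem augHom_quasiIso : QuasiIso (R.augHom k) where
  quasiIsoAt m := by
    induction m with
    | zero =>
      rw [ChainComplex.quasiIsoAt₀_iff, ShortComplex.quasiIso_iff_of_zeros' _ rfl rfl rfl]
      constructor
      · rw [ShortComplex.moduleCat_exact_iff]
        intro x hx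
        have hx' : R.augP k x = 0 := by
          have h0 : ((R.augHom k).f 0).hom x = 0 := hx
          rw [augHom_f_zero] at h0
          exact h0
        obtain ⟨y, hy⟩ := R.exact_zero k x hx'
        refine ⟨y, ?_⟩
        show ((R.cpx k).d 1 0).hom y = x
        rw [cpx_d]
        exact hy
      · rw [ModuleCat.epi_iff_surjective]
        intro c
        refine ⟨Finsupp.single (Idx.nil R k) (algebraMap k (R.Alg k) c), ?_⟩
        show ((R.augHom k).f 0).hom _ = c
        rw [augHom_f_zero]
        show R.aug k (Finsupp.single (Idx.nil R k) (algebraMap k (R.Alg k) c) (Idx.nil R k)) = c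
        rw [Finsupp.single_eq_same]
        exact (R.aug k).commutes _
    | succ m _ =>
      rw [quasiIsoAt_iff_exactAt' (hL := ChainComplex.exactAt_succ_single_obj ..),
          HomologicalComplex.exactAt_iff' _ (m + 2) (m + 1) m (by simp) (by simp),
          ShortComplex.moduleCat_exact_iff]
      intro x hx
      have hx' : R.diff k m x = 0 := by
        have : ((R.cpx k).d (m + 1) m).hom x = 0 := hx
        rw [cpx_d] at this
        exact this
      obtain ⟨y, hy⟩ := R.exact_succ k m x hx'
      refine ⟨y, ?_⟩
      show ((R.cpx k).d (m + 2) (m + 1)).hom y = x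
      rw [cpx_d]
      exact hy

/-- `P_•` as a projective resolution of `k`. -/
noncomputable def res : ProjectiveResolution (R.triv k) where
  complex := R.cpx k
  projective := inferInstance
  π := R.augHom k
  quasiIso := R.augHom_quasiIso k

/-- The basis class `ε_w ∈ Ext^{n+1}_A(k, k)` of an anchored walk `w` of length `n` (a list with
`n + 1` entries): the class of the cocycle `P_{n+1} → k` that is dual to the basis vector `e_w`. -/
noncomputable def eps (w : List (Mon s)) (hw : R.IsAnchored k w) :
    Ext.{u} (R.triv k) (R.triv k) w.length :=
  (R.res k).extMk (n := w.length)
    (ModuleCat.ofHom (R.dualVec k (⟨w, rfl, Or.inr hw⟩ : R.Idx k w.length))) (w.length + 1) rfl (by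
      show (R.cpx k).d (w.length + 1) w.length ≫ _ = 0
      rw [cpx_d]
      erw [← ModuleCat.ofHom_comp]
      rw [dualVec_diff]
      rfl)

/-- The Yoneda algebra `E(A) = ⨁ Ext^i_A(k, k)`. -/
abbrev YonedaAlgebra : Type u := ExtAlgebra.{u} (R.triv k)

/-- The class `ε_w`, as an element of the Yoneda algebra. -/
noncomputable def epsE (w : List (Mon s)) (hw : R.IsAnchored k w) : R.YonedaAlgebra k :=
  DirectSum.of (fun n : ℕ => Ext.{u} (R.triv k) (R.triv k) n) w.length (R.eps k w hw)

/-- The anchored walks `w` with `ε_w` indecomposable. -/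
abbrev IndecWalk : Type :=
  {w : List (Mon s) // ∃ hw : R.IsAnchored k w, ¬ IsDecomposable k (R.eps k w hw)}

/-- The algebra map from the free algebra on the indecomposable anchored walks to `E(A)` that
sends the generator `w` to `ε_w`. -/
noncomputable def presentation :
    MonoidAlgebra k (FreeMonoid (R.IndecWalk k)) →ₐ[k] R.YonedaAlgebra k :=
  MonoidAlgebra.lift k (R.YonedaAlgebra k) (FreeMonoid (R.IndecWalk k))
    (FreeMonoid.lift fun w => R.epsE k w.1 w.2.choose)

end MonomialRelations
end MonomialYoneda

/-! The resolution `P_•` is minimal: the entries π(w_n) of its differential die under the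
augmentation, so every functional P_j → k is a cocycle and only 0 is a coboundary. Hence 1 and the
classes ε_w form a basis of E(A) (`yonedaBasis`), and both claims become statements about its
multiplication table.

To multiply by ε_q, its cocycle is lifted to a chain map P_{m+•} → P_• with the explicit contracting
homotopy. The homotopy sends monomials to monomials or to 0, so e_v goes to 0 or to π(a)e_p, where v
starts with q and a times the product of p is the product of the rest of v (`lift_single_cases`).
Conversely, whenever these products are comparable as suffixes, the lift does reach e_p
(`lift_single_of_comparable`); the combinatorial core is `Interleaved.step`, where the minimality in
the definition of 𝔄_m forces the two products to agree after every second vertex. The augmentation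
keeps only the terms with a = 1. So ε_p ε_q is ±ε_v if some anchored v is q followed by a walk
equivalent to p, and 0 otherwise; such a v is unique.

Every product of basis vectors is thus zero or a nonzero multiple of a basis vector. A basis vector
in the subalgebra generated by other basis vectors must then, by linear independence, be 1 or a
multiple of a genuine product, which gives the criterion for decomposability and the minimality of
the generators. Induction on the degree gives generation. The kernel is handled by
`ker_eq_span_monomials_binomials`: words mapping to 0 give monomials, and two words mapping to the
same line give binomials. -/

namespace MonomialYoneda
-- Yoneda products computed by chain maps between projective resolutions.
section YonedaProduct
universe w v u

open CochainComplex HomComplex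

variable {C : Type u} [Category.{v} C] [Abelian C]

/-- Right shifting a cochain introduces no sign, so the two compositions agree exactly; degreewise
only transports along equalities of indices have to be cancelled. -/
theorem equivHomShift_symm_comp {K L M : CochainComplex C ℤ} {a b c : ℤ} (z₁ : Cocycle K L a)
    (z₂ : Cocycle L M b) (z : Cocycle K M c) (h : b + a = c)
    (hz : (z : Cochain K M c) = (z₁ : Cochain K L a).comp (z₂ : Cochain L M b) (by omega)) :
    ShiftedHom.comp (Cocycle.equivHomShift.symm z₁) (Cocycle.equivHomShift.symm z₂) h =
      Cocycle.equivHomShift.symm z := by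
  subst h
  ext p
  simp [Cocycle.equivHomShift_symm_apply, ShiftedHom.comp, hz, Cochain.rightShift_v _ _ _ _ _ _ _ _ rfl]
  rw [Cochain.comp_v _ _ _ p (p + a) (p + (b + a)) rfl (by omega),
    CochainComplex.shiftFunctorAdd'_inv_app_f']
  have key : ∀ {A B E F : C} (v₁ : A ⟶ B) (v₂ : B ⟶ E) (e : E ⟶ F) (v : B ⟶ F), v₂ ≫ e = v →
      (v₁ ≫ 𝟙 _) ≫ (v₂ ≫ 𝟙 _) ≫ e = (v₁ ≫ v) ≫ 𝟙 _ := by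
    rintro _ _ _ _ v₁ v₂ e _ rfl
    simp
  exact key _ _ _ _ (Cochain.v_comp_XIsoOfEq_hom _ _ _ _ _ _)

/-- The cochain of degree `m` between the extensions of two chain complexes given by a family
`K_{m + j} → L_j`. -/
noncomputable def liftCochain {X Y : C} (R : ProjectiveResolution X) (R' : ProjectiveResolution Y)
    (m : ℕ) (φ : ∀ j, R.complex.X (m + j) ⟶ R'.complex.X j) :
    Cochain R.cochainComplex R'.cochainComplex m :=
  Cochain.mk fun p q hpq =>
    -- The sign makes a family that commutes with the differentials commute up to (-1)^m, which is
    -- the cocycle condition in degree m. In positive degrees the target complex vanishes.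
    if h : q ≤ 0 then ((m : ℤ) * q).negOnePow •
      ((R.cochainComplexXIso p (m + (-q).toNat) (by omega)).hom ≫ φ _ ≫
        (R'.cochainComplexXIso q (-q).toNat (by omega)).inv)
    else 0

variable {X Y Z : C} (R : ProjectiveResolution X) (R' : ProjectiveResolution Y)

theorem liftCochain_v (m : ℕ) (φ : ∀ j, R.complex.X (m + j) ⟶ R'.complex.X j) (p q : ℤ)
    (hpq : p + m = q) (j : ℕ) (hq : -j = q) :
    (liftCochain R R' m φ).v p q hpq = ((m : ℤ) * q).negOnePow •
      ((R.cochainComplexXIso p (m + j) (by omega)).hom ≫ φ j ≫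
        (R'.cochainComplexXIso q j hq).inv) := by
  obtain rfl : j = (-q).toNat := by omega
  rw [liftCochain, Cochain.mk_v, dif_pos (by omega)]

/-- The cocycle given by a chain map `K_{m + •} → L_•`. -/
noncomputable def liftCocycle (m : ℕ) (φ : ∀ j, R.complex.X (m + j) ⟶ R'.complex.X j)
    (hφ : ∀ j, R.complex.d (m + (j + 1)) (m + j) ≫ φ j = φ (j + 1) ≫ R'.complex.d (j + 1) j) :
    Cocycle R.cochainComplex R'.cochainComplex m :=
  Cocycle.mk (liftCochain R R' m φ) (m + 1) rfl (by
    ext p q hpq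
    rw [δ_v _ _ rfl _ p q hpq (q - 1) (p + 1) rfl rfl]
    by_cases hq : q ≤ 0
    · obtain ⟨j, rfl⟩ := Int.exists_eq_neg_ofNat hq
      rw [liftCochain_v R R' m φ p _ _ (j + 1) (by push_cast; ring),
        liftCochain_v R R' m φ (p + 1) _ _ j rfl,
        R'.cochainComplex_d _ _ (j + 1) j (by push_cast; ring) rfl,
        R.cochainComplex_d _ _ (m + (j + 1)) (m + j) (by push_cast; omega) (by push_cast; omega)]
      have hs : ((m : ℤ) * (-(j : ℤ) - 1)).negOnePow = - (((m : ℤ) + 1).negOnePow * ((m : ℤ) * -(j : ℤ)).negOnePow) := by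
        rw [mul_sub, mul_one, Int.negOnePow_sub, Int.negOnePow_succ, mul_comm]
        simp
      simp [reassoc_of% hφ, hs, smul_smul]
    · exact (CochainComplex.isZero_of_isStrictlyLE _ 0 _ (by omega)).eq_of_tgt _ _)

variable [HasExt.{w} C]

/-- In the derived category the class of `zg` is `zg` preceded by the inverse of the
quasi-isomorphism `R'.π'`. Since `zf` is `z` followed by `R'.π'`, the two cancel in the product. -/
theorem extClass_comp {m n : ℕ}
    (zf : Cocycle R.cochainComplex ((CochainComplex.singleFunctor C 0).obj Y) m)
    (zg : Cocycle R'.cochainComplex ((CochainComplex.singleFunctor C 0).obj Z) n)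
    (zfg : Cocycle R.cochainComplex ((CochainComplex.singleFunctor C 0).obj Z) (m + n : ℕ))
    (z : Cocycle R.cochainComplex R'.cochainComplex m) (h₁ : zf = z.postcomp R'.π')
    (h₂ : zfg.1 = z.1.comp zg.1 (by simp)) :
    (R.extEquivCohomologyClass.symm (.mk zf)).comp (R'.extEquivCohomologyClass.symm (.mk zg)) rfl =
      R.extEquivCohomologyClass.symm (.mk zfg) := by
  have := HasDerivedCategory.standard C
  ext
  rw [Ext.comp_hom]
  simp only [ProjectiveResolution.extEquivCohomologyClass_symm_mk_hom]
  rw [← equivHomShift_symm_comp z zg zfg (by push_cast; omega) h₂, h₁,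
    Cocycle.equivHomShift_symm_postcomp, ← ShiftedHom.comp_mk₀ _ 0 rfl]
  simp only [ShiftedHom.map_comp, ShiftedHom.map_mk₀]
  rw [ShiftedHom.comp_assoc (a₂₃ := ((m + n : ℕ) : ℤ)) _ _ _ (add_zero _) (by push_cast; omega)
    (by push_cast; omega)]
  congr 1
  rw [ShiftedHom.comp_assoc _ _ _ (zero_add _) (add_zero _) (by simp [add_comm]),
    ShiftedHom.comp_assoc (a₁ := (m : ℤ)) _ _ _ (by push_cast; omega) (zero_add _) (by simp [add_comm]),
    ShiftedHom.mk₀_comp_mk₀_assoc,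
    ShiftedHom.comp_assoc (a₁ := (m : ℤ)) (a₂ := 0) _ _ _ (zero_add _) (add_zero _) (by simp [add_comm]),
    ShiftedHom.mk₀_comp_mk₀_assoc]
  congr 1
  have h : (DerivedCategory.Q.map R'.π') ≫ (DerivedCategory.singleFunctorIsoCompQ C 0).inv.app Y ≫
      (DerivedCategory.singleFunctorIsoCompQ C 0).hom.app Y ≫
        inv (DerivedCategory.Q.map R'.π') = 𝟙 _ := by
    rw [Iso.inv_hom_id_app_assoc, IsIso.hom_inv_id]
  rw [h, ShiftedHom.mk₀_id_comp]

/-- The sign is that of `liftCochain` in cohomological degree -n; in degree 0, where the lift is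
compared with `f`, it is trivial. -/
theorem extMk_comp_extMk {m n : ℕ} (f : R.complex.X m ⟶ Y) (hf : R.complex.d (m + 1) m ≫ f = 0)
    (g : R'.complex.X n ⟶ Z) (hg : R'.complex.d (n + 1) n ≫ g = 0)
    (φ : ∀ j, R.complex.X (m + j) ⟶ R'.complex.X j)
    (hφ : ∀ j, R.complex.d (m + (j + 1)) (m + j) ≫ φ j = φ (j + 1) ≫ R'.complex.d (j + 1) j)
    (hφ₀ : φ 0 ≫ R'.π.f 0 = f)
    (hφg : R.complex.d (m + n + 1) (m + n) ≫ (((m : ℤ) * n).negOnePow • (φ n ≫ g)) = 0) :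
    (R.extMk f (m + 1) rfl hf).comp (R'.extMk g (n + 1) rfl hg) rfl =
      R.extMk (((m : ℤ) * n).negOnePow • (φ n ≫ g)) (m + n + 1) rfl hφg := by
  refine extClass_comp R R' _ _ _ (liftCocycle R R' m φ hφ) ?_ ?_
  · ext : 1
    refine (Cochain.toSingleEquiv (p := -m) (show (-m : ℤ) + m = 0 by simp)).injective ?_
    have hm : (-m : ℤ) + m = 0 := by simp
    change _ ≫ _ = _ ≫ _
    congr 1
    have h := liftCochain_v R R' m φ _ _ hm 0 (by simp)
    dsimp only [liftCocycle, Cocycle.toSingleMk, Cocycle.mk, Cocycle.postcomp]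
    rw [Cochain.comp_zero_cochain_v, Cochain.ofHom_v, Cochain.toSingleMk_v, h,
      ProjectiveResolution.π'_f_zero, ← hφ₀]
    simp only [mul_zero, Int.negOnePow_zero, one_smul]
    have key : ∀ {A B B' W S : C} (i : A ⟶ B) (p : B ⟶ B') (e : W ≅ B') (q : B' ⟶ Y) (t : Y ⟶ S),
        (i ≫ p ≫ q) ≫ t = (i ≫ p ≫ e.inv) ≫ e.hom ≫ q ≫ t := by simp
    exact key _ _ _ _ _
  · refine (Cochain.toSingleEquiv (p := -(m + n : ℕ))
      (show (-(m + n : ℕ) : ℤ) + (m + n : ℕ) = 0 by simp)).injective ?_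
    have hm : (m : ℤ) + n = (m + n : ℕ) := by simp
    have hp : (-(m + n : ℕ) : ℤ) + m = -n := by push_cast; omega
    have hq : (-n : ℤ) + n = 0 := by simp
    change _ ≫ _ = _ ≫ _
    congr 1
    dsimp only [liftCocycle, Cocycle.toSingleMk, Cocycle.mk]
    rw [Cochain.comp_v _ _ hm _ _ _ hp hq, liftCochain_v R R' m φ _ _ hp n rfl, Cochain.toSingleMk_v, Cochain.toSingleMk_v]
    rw [mul_neg, Int.negOnePow_neg]
    have key : ∀ {A B B' W S : C} (ε : ℤˣ) (i : A ⟶ B) (p : B ⟶ B') (e : W ≅ B') (q : B' ⟶ Z)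
        (t : Z ⟶ S),
        (i ≫ (ε • (p ≫ q))) ≫ t = (ε • (i ≫ p ≫ e.inv)) ≫ (e.hom ≫ q) ≫ t := by
      simp
    exact key _ _ _ _ _ _

end YonedaProduct
end MonomialYoneda

namespace MonomialYoneda
namespace MonomialRelations
universe u

variable {s : ℕ} (R : MonomialRelations s) (k : Type u) [Field k]

/-! ### Finiteness of the bases of the terms P_j. -/

section Finiteness

/-- A generator occurring in `m * v` is not contained in `v`, starts where `m` starts by the
minimality of `m`, and does not end inside `m`. So vertices are letters or left factors of
generators, which leaves finitely many. -/
theorem exists_gen_of_mem_leftAnn {v m : Mon s} (hv : ¬ R.InIdeal k v) (hm : m ∈ R.leftAnn k v) :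
    ∃ r ∈ R.gens, ∃ t, r = m * t := by
  obtain ⟨r, hr, a, c, h⟩ := R.exists_factor_of_mem_ideal k hm.2.1 (m * v)
    (by simp [MonoidAlgebra.of_apply])
  have hin : R.InIdeal k (r * c) := by simpa using R.inIdeal_of_factor k hr 1 c
  rw [mul_assoc] at h
  rcases eq_of_suffix h with ⟨t, rfl⟩ | ⟨t, ht⟩
  · exact absurd (hin.mul_left R t) hv
  · rw [ht, ← mul_assoc] at h
    have hmt := mul_right_cancel h
    have htm := hm.2.2 a t hmt (ht ▸ hin)
    subst htm
    have h' : FreeMonoid.toList t ++ FreeMonoid.toList v =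
      FreeMonoid.toList r ++ FreeMonoid.toList c := ht.symm
    rcases List.append_eq_append_iff.1 h' with ⟨z, hz, -⟩ | ⟨z, hz, -⟩
    · exact ⟨r, hr, FreeMonoid.ofList z, hz⟩
    · refine absurd ?_ hm.1
      have : t = 1 * r * FreeMonoid.ofList z := by rw [one_mul]; exact hz
      rw [this]
      exact R.inIdeal_of_factor k hr _ _

theorem finite_vert : (R.vert k).Finite := by
  have hfin : (vert₀ s ∪ ⋃ r ∈ R.gens, {m : Mon s | ∃ t, r = m * t}).Finite := by
    refine (Set.finite_range _).union (R.gens.finite_toSet.biUnion fun r _ => ?_)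
    refine (List.finite_toSet (FreeMonoid.toList r).inits).subset ?_
    rintro m ⟨t, rfl⟩
    exact (List.mem_inits _ _).2 ⟨t, rfl⟩
  refine hfin.subset fun m hm => ?_
  obtain ⟨i, hi⟩ := Set.mem_iUnion.1 hm
  cases i with
  | zero => exact Or.inl hi
  | succ i =>
    obtain ⟨w, hw, hmw⟩ := Set.mem_iUnion₂.1 hi
    obtain ⟨r, hr, t, ht⟩ := R.exists_gen_of_mem_leftAnn k
      (R.not_inIdeal_of_mem_vert k (Set.mem_iUnion.2 ⟨i, hw⟩)) hmw
    exact Or.inr (Set.mem_iUnion₂.2 ⟨r, hr, t, ht⟩)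

variable {R k} in
theorem IsIndex.mem_vert {l : List (Mon s)} (hl : R.IsIndex k l) {v : Mon s} (hv : v ∈ l) :
    v ∈ R.vert k := by
  rcases hl with rfl | hl
  · simp at hv
  · exact hl.1.2.1 v hv

instance (j : ℕ) : Finite (R.Idx k j) := by
  have := (R.finite_vert k).to_subtype
  refine Finite.of_injective (fun (w : R.Idx k j) (i : Fin j) =>
    (⟨w.1.get (i.cast w.2.1.symm), w.2.2.mem_vert (List.get_mem _ _)⟩ : R.vert k)) ?_
  intro w w' h
  refine Subtype.ext (List.ext_get (w.2.1.trans w'.2.1.symm) fun n h₁ h₂ => ?_)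
  exact congrArg Subtype.val (congrFun h ⟨n, w.2.1 ▸ h₁⟩)

end Finiteness

/-! ### Lifting dual cocycles to chain maps; combinatorics of comparable walks. -/

section Lift

/-- The lift of the cocycle dual to `e_q` to a chain map `P_{m + •} → P_•`. -/
noncomputable def lift {m : ℕ} (q : R.Idx k m) :
    ∀ j, (R.Idx k (m + j) →₀ R.Alg k) →ₗ[R.Alg k] (R.Idx k j →₀ R.Alg k)
  | 0 => Finsupp.lsingle (Idx.nil R k) ∘ₗ Finsupp.lapply q
  -- The usual comparison recursion. It is prescribed on basis vectors and then extended
  -- `A`-linearly, because the homotopy is only additive.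
  | j + 1 => Finsupp.linearCombination (R.Alg k) fun v =>
      R.htpy k j (lift q j (R.diff k (m + j) (Finsupp.single v 1)))

theorem lift_succ_single {m j : ℕ} (q : R.Idx k m) (v : R.Idx k (m + j + 1)) (a : R.Alg k) :
    R.lift k q (j + 1) (Finsupp.single v a) =
      a • R.htpy k j (R.lift k q j (R.diff k (m + j) (Finsupp.single v 1))) := by
  exact Finsupp.linearCombination_single _ _ _

theorem lift_succ_single_one {m j : ℕ} (q : R.Idx k m) (v : R.Idx k (m + j + 1)) :
    R.lift k q (j + 1) (Finsupp.single v 1) =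
      R.htpy k j (R.proj k (MonoidAlgebra.of k _ v.last) •
        R.lift k q j (Finsupp.single v.init 1)) := by
  rw [← map_smul, Finsupp.smul_single, smul_eq_mul, mul_one,
    ← one_mul (R.proj k (MonoidAlgebra.of k _ v.last)), ← diff_single]
  exact (R.lift_succ_single k q v 1).trans (Finsupp.ext fun _ => one_mul _)

/-- The homotopy is a section of the differential on cycles. What it is applied to is a cycle by
induction and d² = 0; at the bottom the augmentation kills it because the last vertex of a walk is
not 1. -/
theorem diff_lift {m : ℕ} (q : R.Idx k m) (j : ℕ) :
    R.diff k j ∘ₗ R.lift k q (j + 1) = R.lift k q j ∘ₗ R.diff k (m + j) := by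
  induction j with
  | zero =>
    refine Finsupp.lhom_ext fun v a => ?_
    rw [LinearMap.comp_apply, lift_succ_single, map_smul]
    have h := R.homotopy_zero k (R.lift k q 0 (R.diff k (m + 0) (Finsupp.single v 1)))
    have h0 : R.augP k (R.lift k q 0 (R.diff k (m + 0) (Finsupp.single v 1))) = 0 := by
      rw [diff_single, augP]
      show R.aug k (Finsupp.single _ (Finsupp.single v.init _ q) _) = 0
      rw [Finsupp.single_eq_same]
      by_cases h : v.init = q
      · rw [h, Finsupp.single_eq_same, map_mul,
          R.aug_proj_of k (R.ne_one_of_next k v.init.2.2 (Idx.next R k v)), mul_zero]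
      · rw [Finsupp.single_eq_of_ne' h, map_zero]
    rw [h0, map_zero, Finsupp.single_zero, add_zero] at h
    rw [h, ← map_smul, ← map_smul, Finsupp.smul_single, smul_eq_mul, mul_one]
    rfl
  | succ j ih =>
    refine Finsupp.lhom_ext fun v a => ?_
    rw [LinearMap.comp_apply, lift_succ_single, map_smul]
    have h := R.homotopy_succ k (R.lift k q (j + 1) (R.diff k (m + (j + 1)) (Finsupp.single v 1)))
    have h0 : R.diff k j (R.lift k q (j + 1) (R.diff k (m + (j + 1)) (Finsupp.single v 1))) = 0 := by
      rw [← LinearMap.comp_apply, ih, LinearMap.comp_apply, ← LinearMap.comp_apply (R.diff k (m + j))]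
      erw [R.diff_diff k (m + j)]
      simp
    rw [h0, map_zero, add_zero] at h
    rw [h, ← map_smul, ← map_smul, Finsupp.smul_single, smul_eq_mul, mul_one]
    rfl

variable {R k} in
/-- The product `w_n ⊗ ⋯ ⊗ w_m` over the vertices of a walk after the first `m`. -/
def Idx.prodFrom (m : ℕ) {j : ℕ} (v : R.Idx k j) : Mon s := (v.1.drop m).reverse.prod

theorem Idx.prodFrom_succ {m j : ℕ} (v : R.Idx k (m + j + 1)) :
    v.prodFrom m = v.last * v.init.prodFrom m := by
  have h := Idx.dropLast_append R k v
  have hl : m ≤ v.1.dropLast.length := by rw [List.length_dropLast, v.2.1]; omega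
  rw [Idx.prodFrom, ← h, List.drop_append_of_le_length hl, List.reverse_append]
  simp [Idx.prodFrom, Idx.init]

theorem Idx.prodFrom_zero_succ {j : ℕ} (v : R.Idx k (j + 1)) :
    v.prodFrom 0 = v.last * v.init.prodFrom 0 := by
  have h := Idx.dropLast_append R k v
  rw [Idx.prodFrom, ← h, List.drop_zero, List.reverse_append]
  simp [Idx.prodFrom, Idx.init]

theorem Idx.prodFrom_self {j : ℕ} (v : R.Idx k j) : v.prodFrom j = 1 := by
  rw [Idx.prodFrom, List.drop_eq_nil_of_le (by rw [v.2.1])]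
  rfl

/-- Reduces each step of the lift to words: multiply by the last vertex of `v`, then split off the
next vertex of `p` on the right, if there is one. -/
theorem lift_succ_of_lift_eq {m j : ℕ} (q : R.Idx k m) (v : R.Idx k (m + j + 1)) {p : R.Idx k j}
    {a : Mon s} (h : R.lift k q j (Finsupp.single v.init 1) =
      Finsupp.single p (R.proj k (MonoidAlgebra.of k _ a))) :
    R.lift k q (j + 1) (Finsupp.single v 1) = R.htpyMon k p (v.last * a) := by
  rw [lift_succ_single_one, h, Finsupp.smul_single, smul_eq_mul, ← map_mul, ← map_mul,
    htpy_single, htpyT_of]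

/-- Each step of the recursion either kills the monomial or moves a right factor of the coefficient
into the walk, so the total product is preserved. -/
theorem lift_single_cases {m : ℕ} (q : R.Idx k m) (j : ℕ) (v : R.Idx k (m + j)) :
    R.lift k q j (Finsupp.single v 1) = 0 ∨ ∃ (a : Mon s) (p : R.Idx k j), v.1.take m = q.1 ∧
      R.lift k q j (Finsupp.single v 1) = Finsupp.single p (R.proj k (MonoidAlgebra.of k _ a)) ∧
      a * p.prodFrom 0 = v.prodFrom m := by
  induction j with
  | zero =>
    have h : R.lift k q 0 (Finsupp.single v 1) =
      Finsupp.single (Idx.nil R k) (Finsupp.single (M := R.Alg k) v 1 q) := rfl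
    by_cases hv : v = q
    · subst hv
      refine Or.inr ⟨1, Idx.nil R k, ?_, ?_, ?_⟩
      · exact List.take_of_length_le (by rw [v.2.1]; simp)
      · rw [h, Finsupp.single_eq_same, map_one, map_one]
      · erw [Idx.prodFrom_self, Idx.prodFrom_self]; rfl
    · left
      rw [h, Finsupp.single_eq_of_ne' hv, Finsupp.single_zero]
  | succ j ih =>
    change R.Idx k (m + j + 1) at v
    rcases ih v.init with h | ⟨a, p, hq, h, hp⟩
    · left
      rw [lift_succ_single_one, h, smul_zero, map_zero]
    · rw [R.lift_succ_of_lift_eq k q v h]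
      by_cases hI : R.InIdeal k (v.last * a)
      · exact Or.inl (R.htpyMon_of_mem k p hI)
      by_cases hn : ∃ t : Mon s × Mon s, v.last * a = t.1 * t.2 ∧ R.Next k p.1 t.2
      · obtain ⟨⟨c, d⟩, hcd, hd⟩ := hn
        dsimp only at hcd hd
        refine Or.inr ⟨c, p.snoc d hd, ?_, ?_, ?_⟩
        · rw [← hq, ← Idx.dropLast_append R k v, List.take_append_of_le_length]
          · rfl
          · rw [List.length_dropLast, v.2.1]; omega
        · rw [hcd] at hI ⊢
          rw [R.htpyMon_mul k p c d hI hd]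
        · rw [Idx.prodFrom_zero_succ, Idx.prodFrom_succ, Idx.init_snoc, Idx.last_snoc, ← mul_assoc,
            ← hcd, mul_assoc, hp]
      · exact Or.inl (R.htpyMon_of_not k p hn)

/-- The interleaving of a walk and an anchored walk whose products are comparable: `a` is the
excess of the first product over the second one. -/
def Interleaved (l l' : List (Mon s)) (a : Mon s) : Prop :=
  (a = 1 ∧ (l' = [] ∨ ∃ x c, l.getLast? = some x ∧ l'.getLast? = some (x * c))) ∨
    ∃ y, l.getLast? = some (a * y) ∧ l'.getLast? = some y

/-- The two alternatives of `Interleaved` alternate. From equal products, `b` is a suffix of `w`,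
which leaves an excess `a'`; from an excess `a`, the next step gives `w * a = b` and the products
agree again. In particular the coefficient never falls into `I`, so the lift does not vanish. -/
theorem Interleaved.step {l l' : List (Mon s)} {a b w x y : Mon s} (h : Interleaved l l' a)
    (hl : R.IsIndex k l) (hl' : R.IsIndex k l') (hw : R.Next k l w) (hb : R.Next k l' b)
    (hxy : x * (w * a) = y * b) :
    ¬ R.InIdeal k (w * a) ∧ ∃ a', w * a = a' * b ∧ Interleaved (l ++ [w]) (l' ++ [b]) a' := by
  have hwI : ¬ R.InIdeal k w := R.not_inIdeal_of_mem_vert k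
    (((R.isIndex_append_iff k l w).2 ⟨hl, hw⟩).mem_vert (by simp))
  have hbI : ¬ R.InIdeal k b := R.not_inIdeal_of_mem_vert k
    (((R.isIndex_append_iff k l' b).2 ⟨hl', hb⟩).mem_vert (by simp))
  rcases h with ⟨rfl, h⟩ | ⟨z, hz, hz'⟩
  · rw [mul_one] at hxy ⊢
    refine ⟨hwI, ?_⟩
    suffices ∃ a', w = a' * b by
      obtain ⟨a', rfl⟩ := this
      exact ⟨a', rfl, Or.inr ⟨b, by simp, by simp⟩⟩
    rcases eq_of_suffix hxy with h' | ⟨t, ht⟩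
    · exact h'
    -- Now `w` is a suffix of `b`. If the second walk is empty, `b` is a letter and `w ≠ 1`, so they
    -- coincide.
    · rcases h with rfl | ⟨z, c, hz, hz'⟩
      · rcases hb with ⟨-, hb⟩ | ⟨v, hv, -⟩
        · have h1 := length_of_mem_vert₀ hb
          have h2 : FreeMonoid.length w ≠ 0 := fun h0 =>
            R.ne_one_of_next k hl hw (FreeMonoid.length_eq_zero.1 h0)
          have h3 := congrArg FreeMonoid.length ht
          rw [FreeMonoid.length_mul] at h3
          have : t = 1 := FreeMonoid.length_eq_zero.1 (by omega)
          exact ⟨1, by rw [ht, this]; simp⟩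
        · simp at hv
      · rcases hb with ⟨rfl, -⟩ | ⟨v, hv, hb⟩
        · simp at hz'
        rcases hw with ⟨rfl, -⟩ | ⟨v', hv', hw⟩
        · simp at hz
        obtain rfl : z * c = v := Option.some.inj (hz'.symm.trans hv)
        obtain rfl : z = v' := Option.some.inj (hz.symm.trans hv')
        -- Already `w * z` lies in `I`; hence `w` cannot be a proper suffix of `b`, by the
        -- minimality of `b` against `z * c`.
        have hI : R.InIdeal k (w * (z * c)) := by
          rw [← mul_assoc]
          unfold InIdeal
          rw [map_mul]
          exact TwoSidedIdeal.mul_mem_right _ _ _ hw.2.1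
        exact ⟨1, by rw [one_mul]; exact hb.2.2 t w ht hI⟩
  · rcases hb with ⟨rfl, -⟩ | ⟨v, hv, hb⟩
    · simp at hz'
    rcases hw with ⟨rfl, -⟩ | ⟨v', hv', hw⟩
    · simp at hz
    obtain rfl : z = v := Option.some.inj (hz'.symm.trans hv)
    obtain rfl : a * z = v' := Option.some.inj (hz.symm.trans hv')
    have hazI : ¬ R.InIdeal k (a * z) := R.not_inIdeal_of_mem_vert k
      (hl.mem_vert (List.mem_of_getLast? hv'))
    have hI : R.InIdeal k (w * a * z) := by rw [mul_assoc]; exact hw.2.1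
    suffices h : w * a = b by
      refine ⟨h ▸ hbI, 1, by rw [h, one_mul], Or.inl ⟨rfl, Or.inr ⟨w, a, by simp, ?_⟩⟩⟩
      rw [h]; simp
    rcases eq_of_suffix hxy with ⟨t, ht⟩ | ⟨t, ht⟩
    -- If `b` were a suffix of `a`, the vertex `a * z` would lie in `I`. Otherwise `b = r * a`, and
    -- the minimality of `w` against `a * z` forces `r = w`.
    · rcases eq_of_suffix ht with ⟨r, rfl⟩ | ⟨r, rfl⟩
      · rw [mul_assoc] at hazI
        exact absurd (hb.2.1.mul_left R r) hazI
      · rw [← mul_assoc] at ht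
        have := hw.2.2 t r (mul_right_cancel ht) (by rw [← mul_assoc]; exact hb.2.1)
        rw [this]
    · exact hb.2.2 t (w * a) ht hI

/-- Comparability, rather than equality, of the products is what passes to the walks with their last
vertices removed; hence the arbitrary left factors `x` and `y`. -/
theorem lift_single_of_comparable {m : ℕ} (q : R.Idx k m) (j : ℕ) (v : R.Idx k (m + j))
    (p : R.Idx k j) (hv : v.1.take m = q.1) {x y : Mon s}
    (h : x * v.prodFrom m = y * p.prodFrom 0) :
    ∃ a, v.prodFrom m = a * p.prodFrom 0 ∧ Interleaved v.1 p.1 a ∧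
      R.lift k q j (Finsupp.single v 1) = Finsupp.single p (R.proj k (MonoidAlgebra.of k _ a)) := by
  induction j generalizing x y with
  | zero =>
    obtain rfl : v = q := Subtype.ext (by rw [← hv, List.take_of_length_le (by rw [v.2.1]; simp)])
    obtain rfl := Idx.eq_nil R k p
    refine ⟨1, ?_, Or.inl ⟨rfl, Or.inl rfl⟩, ?_⟩
    · erw [Idx.prodFrom_self, Idx.prodFrom_self]; rfl
    · show Finsupp.single (Idx.nil R k) (Finsupp.single (M := R.Alg k) v 1 v) = _
      rw [Finsupp.single_eq_same, map_one, map_one]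
  | succ j ih =>
    change R.Idx k (m + j + 1) at v
    have hvi : v.init.1.take m = q.1 := by
      rw [← hv, ← Idx.dropLast_append R k v, List.take_append_of_le_length]
      · rfl
      · rw [List.length_dropLast, v.2.1]; omega
    rw [Idx.prodFrom_zero_succ, Idx.prodFrom_succ, ← mul_assoc, ← mul_assoc] at h
    obtain ⟨a, ha, hint, hlift⟩ := ih v.init p.init hvi h
    rw [ha, ← mul_assoc] at h
    have h' := mul_right_cancel h
    rw [mul_assoc] at h'
    obtain ⟨hI, a', ha', hint'⟩ := Interleaved.step R k hint v.init.2.2 p.init.2.2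
      (Idx.next R k v) (Idx.next R k p) h'
    refine ⟨a', ?_, ?_, ?_⟩
    · rw [Idx.prodFrom_zero_succ, Idx.prodFrom_succ, ha, ← mul_assoc, ha', mul_assoc]
    · rw [← Idx.dropLast_append R k v, ← Idx.dropLast_append R k p]
      exact hint'
    · rw [R.lift_succ_of_lift_eq k q v hlift]
      rw [ha'] at hI ⊢
      rw [R.htpyMon_mul k p.init a' p.last hI (Idx.next R k p), Idx.snoc_init]

/-- A word has at most one right factor that continues a given walk (`next_unique`), so the common
start and the product determine the vertices one at a time. -/
theorem eq_of_prodFrom_comparable {m j : ℕ} (v v' : R.Idx k (m + j))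
    (hv : v.1.take m = v'.1.take m) {x y : Mon s} (h : x * v.prodFrom m = y * v'.prodFrom m) :
    v = v' := by
  induction j generalizing x y with
  | zero =>
    rw [List.take_of_length_le (by rw [v.2.1]; simp),
      List.take_of_length_le (by rw [v'.2.1]; simp)] at hv
    exact Subtype.ext hv
  | succ j ih =>
    change R.Idx k (m + j + 1) at v v'
    have hinit : ∀ v : R.Idx k (m + j + 1), v.1.take m = v.init.1.take m := by
      intro v
      rw [← Idx.dropLast_append R k v, List.take_append_of_le_length]
      · rfl
      · rw [List.length_dropLast, v.2.1]; omega
    rw [Idx.prodFrom_succ, Idx.prodFrom_succ, ← mul_assoc, ← mul_assoc] at h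
    have hi := ih v.init v'.init (by rw [← hinit, ← hinit, hv]) h
    rw [hi] at h
    have hl := (R.next_unique k (mul_right_cancel h) (Idx.next R k v)
      (hi ▸ Idx.next R k v')).2
    refine Subtype.ext ?_
    rw [← Idx.dropLast_append R k v, ← Idx.dropLast_append R k v', hl]
    exact congrArg (· ++ _) (congrArg Subtype.val hi)

end Lift

end MonomialRelations
end MonomialYoneda

namespace MonomialYoneda
namespace MonomialRelations
universe u

variable {s : ℕ} (R : MonomialRelations s) (k : Type u) [Field k]

/-! ### Minimality of the resolution and the basis of E(A). -/

section ExtBasis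

/-- The `A`-linear map `P_j → k` with given values on the basis. -/
noncomputable def functional {j : ℕ} (c : R.Idx k j → k) :
    (R.Idx k j →₀ R.Alg k) →ₗ[R.Alg k] R.TrivCarrier k :=
  Finsupp.linearCombination (R.Alg k) (show R.Idx k j → R.TrivCarrier k from c)

theorem functional_single {j : ℕ} (c : R.Idx k j → k) (w : R.Idx k j) (a : R.Alg k) :
    R.functional k c (Finsupp.single w a) = (show R.TrivCarrier k from R.aug k a * c w) :=
  Finsupp.linearCombination_single _ _ _

theorem functional_ext {j : ℕ} {f g : (R.Idx k j →₀ R.Alg k) →ₗ[R.Alg k] R.TrivCarrier k}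
    (h : ∀ w, f (Finsupp.single w 1) = g (Finsupp.single w 1)) : f = g :=
  Finsupp.lhom_ext' fun w => LinearMap.ext_ring (h w)

theorem functional_eq {j : ℕ} (f : (R.Idx k j →₀ R.Alg k) →ₗ[R.Alg k] R.TrivCarrier k) :
    R.functional k (fun w => f (Finsupp.single w 1)) = f :=
  R.functional_ext k fun w => by
    refine (R.functional_single k _ w 1).trans ?_
    rw [map_one]
    exact one_mul (M := k) _

open Classical in
theorem functional_single_eq_dualVec {j : ℕ} (w : R.Idx k j) :
    R.functional k (Pi.single w 1) = R.dualVec k w :=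
  R.functional_ext k fun v => by
    rw [functional_single, map_one]
    show (1 : k) * _ = R.aug k (Finsupp.single v (1 : R.Alg k) w)
    by_cases h : v = w
    · subst h
      rw [Finsupp.single_eq_same, Pi.single_eq_same, map_one, mul_one]
    · rw [Finsupp.single_eq_of_ne' h, Pi.single_eq_of_ne h, map_zero, mul_zero]

/-- Minimality: the differential multiplies by monomials different from 1, on which the augmentation
vanishes. -/
theorem functional_comp_diff {j : ℕ}
    (f : (R.Idx k j →₀ R.Alg k) →ₗ[R.Alg k] R.TrivCarrier k) : f ∘ₗ R.diff k j = 0 := by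
  refine R.functional_ext k fun v => ?_
  rw [LinearMap.comp_apply, diff_single, ← R.functional_eq k f]
  refine (R.functional_single k _ _ _).trans ?_
  rw [map_mul, R.aug_proj_of k (R.ne_one_of_next k v.init.2.2 (Idx.next R k v)), mul_zero]
  exact zero_mul (M₀ := k) _

theorem d_comp_ofHom {j : ℕ} (f : (R.Idx k j →₀ R.Alg k) →ₗ[R.Alg k] R.TrivCarrier k) :
    (R.res k).complex.d (j + 1) j ≫ ModuleCat.ofHom f = 0 := by
  show (R.cpx k).d (j + 1) j ≫ _ = 0
  rw [cpx_d]
  exact ModuleCat.hom_ext (R.functional_comp_diff k f)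

/-- The class in `Ext^j(k, k)` of an `A`-linear map `P_j → k`; each of these is a cocycle. -/
noncomputable def extClass {j : ℕ}
    (f : (R.Idx k j →₀ R.Alg k) →ₗ[R.Alg k] R.TrivCarrier k) :
    Ext.{u} (R.triv k) (R.triv k) j :=
  (R.res k).extMk (n := j) (ModuleCat.ofHom f) (j + 1) rfl (R.d_comp_ofHom k f)

theorem extClass_add {j : ℕ} (f g : (R.Idx k j →₀ R.Alg k) →ₗ[R.Alg k] R.TrivCarrier k) :
    R.extClass k (f + g) = R.extClass k f + R.extClass k g :=
  ((R.res k).add_extMk (n := j) (ModuleCat.ofHom f) (ModuleCat.ofHom g) _ rfl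
    (R.d_comp_ofHom k f) (R.d_comp_ofHom k g)).symm

theorem smul_extClass_functional {j : ℕ} (a : k) (c : R.Idx k j → k) :
    R.extClass k (R.functional k (a • c)) = a • R.extClass k (R.functional k c) := by
  rw [Ext.smul_eq_comp_mk₀]
  refine Eq.trans ?_ ((R.res k).extMk_comp_mk₀ (n := j) (ModuleCat.ofHom (R.functional k c)) _ rfl
    (R.d_comp_ofHom k _) (a • 𝟙 (R.triv k))).symm
  refine congrArg (fun f => R.extClass k f) (R.functional_ext k fun w => ?_)
  show _ = (a • 𝟙 (R.triv k) : R.triv k ⟶ R.triv k).hom (R.functional k c (Finsupp.single w 1))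
  rw [functional_single, functional_single]
  show _ = R.aug k (algebraMap k (R.Alg k) a) * _
  rw [AlgHom.commutes, map_one]
  exact (one_mul _).trans (congrArg (a * ·) (one_mul (c w)).symm)

theorem extClass_surjective {j : ℕ} (α : Ext.{u} (R.triv k) (R.triv k) j) :
    ∃ c : R.Idx k j → k, R.extClass k (R.functional k c) = α := by
  obtain ⟨f, _, rfl⟩ := (R.res k).extMk_surjective α (j + 1) rfl
  exact ⟨_, congrArg (fun f => R.extClass k f) (R.functional_eq k f.hom)⟩

/-- The lift of `q`, as morphisms of `A`-modules. -/
noncomputable def liftHom {m : ℕ} (q : R.Idx k m) (j : ℕ) :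
    (R.res k).complex.X (m + j) ⟶ (R.res k).complex.X j :=
  ModuleCat.ofHom (R.lift k q j)

theorem extClass_dualVec_comp {m n : ℕ} (q : R.Idx k m)
    (f : (R.Idx k n →₀ R.Alg k) →ₗ[R.Alg k] R.TrivCarrier k) :
    (R.extClass k (R.dualVec k q)).comp (R.extClass k f) rfl =
      R.extClass k (((m : ℤ) * n).negOnePow • (f ∘ₗ R.lift k q n)) := by
  refine (extMk_comp_extMk (R.res k) (R.res k) (m := m) (n := n)
    (ModuleCat.ofHom (R.dualVec k q)) (R.d_comp_ofHom k _)
    (ModuleCat.ofHom f) (R.d_comp_ofHom k _) (R.liftHom k q) (fun j => ?_) ?_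
    (R.d_comp_ofHom k (((m : ℤ) * n).negOnePow • (f ∘ₗ R.lift k q n)))).trans ?_
  · show (R.cpx k).d _ _ ≫ _ = _ ≫ (R.cpx k).d _ _
    rw [cpx_d]
    erw [R.cpx_d k (m + j)]
    exact ModuleCat.hom_ext (R.diff_lift k q j).symm
  · show _ ≫ (R.augHom k).f 0 = _
    rw [augHom_f_zero]
    refine ModuleCat.hom_ext (R.functional_ext k fun w => ?_)
    show R.aug k (Finsupp.single (Idx.nil R k) _ _) = R.aug k _
    rw [Finsupp.single_eq_same]
    rfl
  · rfl

/-- The lift of the empty walk is the identity in degree 0, so multiplying this class by the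
identity class, written as some functional `c`, returns the class of `c`. -/
theorem extClass_dualVec_nil :
    R.extClass k (R.dualVec k (Idx.nil R k)) = Ext.mk₀ (𝟙 (R.triv k)) := by
  obtain ⟨c, hc⟩ := R.extClass_surjective k (Ext.mk₀ (𝟙 (R.triv k)))
  refine (Ext.comp_mk₀_id _).symm.trans ?_
  rw [← hc]
  refine (R.extClass_dualVec_comp k (Idx.nil R k) (R.functional k c)).trans ?_
  refine congrArg (fun f => R.extClass k f) (R.functional_ext k fun w => ?_)
  obtain rfl := Idx.eq_nil R k w
  have h : R.lift k (Idx.nil R k) 0 (Finsupp.single (Idx.nil R k) 1) =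
      Finsupp.single (Idx.nil R k) (Finsupp.single (M := R.Alg k) (Idx.nil R k) 1
        (Idx.nil R k)) := rfl
  rw [Finsupp.single_eq_same] at h
  rw [Nat.cast_zero, mul_zero, Int.negOnePow_zero, one_smul]
  exact congrArg (R.functional k c) h

theorem extClass_functional_injective (j : ℕ) (c : R.Idx k j → k)
    (h : R.extClass k (R.functional k c) = 0) : c = 0 := by
  cases j with
  -- No term precedes P_0. Here the class is a multiple of the identity, and Hom(k, k) embeds in
  -- Ext^0, so evaluation at 1 recovers the scalar.
  | zero =>
    have hc : R.functional k c = R.functional k (c (Idx.nil R k) • fun _ => 1) := by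
      congr 1
      funext w
      rw [Idx.eq_nil R k w]
      simp
    have h1 : R.functional k (fun _ => 1) = R.dualVec k (Idx.nil R k) := by
      classical
      rw [← functional_single_eq_dualVec]
      congr 1
      funext w
      rw [Idx.eq_nil R k w, Pi.single_eq_same]
    rw [hc, smul_extClass_functional, h1, extClass_dualVec_nil, ← Ext.mk₀_smul] at h
    have h0 := (Ext.mk₀_bijective _ _).1 (h.trans (Ext.mk₀_zero _ _).symm)
    have h2 : (c (Idx.nil R k) • 𝟙 (R.triv k) : R.triv k ⟶ R.triv k).hom (1 : k) = (0 : k) := by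
      rw [h0]; rfl
    have h3 : R.aug k (algebraMap k (R.Alg k) (c (Idx.nil R k))) * 1 = 0 := h2
    rw [AlgHom.commutes, mul_one] at h3
    funext w
    rw [Idx.eq_nil R k w]
    exact h3
  | succ j =>
    -- A coboundary is `g` composed with the differential, which is 0 by minimality.
    obtain ⟨g, hg⟩ := ((R.res k).extMk_eq_zero_iff _ _ rfl (R.d_comp_ofHom k _) j rfl).1 h
    have hg' := (congrArg ModuleCat.Hom.hom hg).symm.trans
      (congrArg ModuleCat.Hom.hom (R.d_comp_ofHom k g.hom))
    funext w
    have := LinearMap.congr_fun hg' (Finsupp.single w 1)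
    refine Eq.trans ?_ (this : (_ : k) = 0)
    refine Eq.trans ?_ (R.functional_single k c w 1).symm
    simp

/-- The linear equivalence between functions on the basis of `P_j` and `Ext^j(k, k)`. -/
noncomputable def extEquiv (j : ℕ) :
    (R.Idx k j → k) ≃ₗ[k] Ext.{u} (R.triv k) (R.triv k) j :=
  LinearEquiv.ofBijective
    { toFun := fun c => R.extClass k (R.functional k c)
      map_add' := fun c d => by
        rw [← extClass_add]
        congr 1
        refine R.functional_ext k fun w => ?_
        rw [LinearMap.add_apply, functional_single, functional_single, functional_single]
        exact mul_add (R.aug k 1) (c w) (d w)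
      map_smul' := fun a c => R.smul_extClass_functional k a c }
    ⟨(injective_iff_map_eq_zero _).2 (R.extClass_functional_injective k j),
      R.extClass_surjective k⟩

/-- The basis of `Ext^j(k, k)` dual to the basis of `P_j`. -/
noncomputable def extBasis (j : ℕ) : Module.Basis (R.Idx k j) k (Ext.{u} (R.triv k) (R.triv k) j) :=
  (Pi.basisFun k (R.Idx k j)).map (R.extEquiv k j)

theorem extBasis_apply {j : ℕ} (w : R.Idx k j) :
    R.extBasis k j w = R.extClass k (R.dualVec k w) := by
  classical
  rw [extBasis, Module.Basis.map_apply, Pi.basisFun_apply, ← functional_single_eq_dualVec]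
  rfl

/-- The basis of the Yoneda algebra given by the empty walk and the anchored walks. -/
noncomputable def yonedaBasis : Module.Basis (Σ j, R.Idx k j) k (R.YonedaAlgebra k) :=
  DFinsupp.basis (R.extBasis k)

theorem yonedaBasis_apply {j : ℕ} (w : R.Idx k j) :
    R.yonedaBasis k ⟨j, w⟩ = DirectSum.of (fun n : ℕ => Ext.{u} (R.triv k) (R.triv k) n) j
      (R.extClass k (R.dualVec k w)) := by
  classical
  rw [← extBasis_apply, Module.Basis.apply_eq_iff]
  ext ⟨i, v⟩
  show (R.extBasis k i).repr (DirectSum.of (fun n : ℕ => Ext.{u} (R.triv k) (R.triv k) n) j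
    (R.extBasis k j w) i) v = _
  by_cases h : j = i
  · subst h
    rw [DirectSum.of_eq_same, Module.Basis.repr_self]
    by_cases hv : w = v
    · subst hv; simp
    · rw [Finsupp.single_eq_of_ne' hv, Finsupp.single_eq_of_ne' (by simpa using hv)]
  · rw [DirectSum.of_eq_of_ne _ _ _ (Ne.symm h), map_zero, Finsupp.single_eq_of_ne' (by rintro ⟨⟩; exact h rfl)]
    rfl

end ExtBasis

end MonomialRelations
end MonomialYoneda

namespace MonomialYoneda
namespace MonomialRelations
universe u

variable {s : ℕ} (R : MonomialRelations s) (k : Type u) [Field k]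

/-! ### The multiplication table of the basis. -/

section Product

variable {R k} in
/-- The walk `v` is `q` followed by a walk equivalent to `p`. -/
def Idx.IsConcat {m n : ℕ} (q : R.Idx k m) (p : R.Idx k n) (v : R.Idx k (m + n)) : Prop :=
  v.1.take m = q.1 ∧ v.prodFrom m = p.prodFrom 0

open Classical in
-- The coefficient at `p` is 0 or π(a), and the augmentation of π(a) is 1 or 0 according to whether
-- `a = 1`, that is, whether the products agree exactly.
theorem dualVec_lift_single {m n : ℕ} (q : R.Idx k m) (p : R.Idx k n) (v : R.Idx k (m + n)) :
    R.aug k (R.lift k q n (Finsupp.single v 1) p) = if Idx.IsConcat q p v then (1 : k) else 0 := by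
  split_ifs with h
  · obtain ⟨a, ha, -, hl⟩ := R.lift_single_of_comparable k q n v p h.1
      (show 1 * v.prodFrom m = 1 * p.prodFrom 0 by rw [h.2])
    rw [h.2] at ha
    have ha1 : a = 1 := (mul_right_cancel ((one_mul _).trans ha)).symm
    rw [hl, ha1, Finsupp.single_eq_same, map_one, map_one, map_one]
  · rcases R.lift_single_cases k q n v with h0 | ⟨a, p', hq, h0, hp⟩
    · rw [h0]
      exact map_zero _
    · rw [h0]
      by_cases hpp : p' = p
      · subst hpp
        rw [Finsupp.single_eq_same]
        by_cases ha : a = 1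
        · subst ha
          exact absurd ⟨hq, by rw [← hp, one_mul]⟩ h
        · exact R.aug_proj_of k ha
      · rw [Finsupp.single_eq_of_ne' hpp, map_zero]

theorem Idx.IsConcat.unique {m n : ℕ} {q : R.Idx k m} {p : R.Idx k n} {v v' : R.Idx k (m + n)}
    (h : Idx.IsConcat q p v) (h' : Idx.IsConcat q p v') : v = v' :=
  R.eq_of_prodFrom_comparable k v v' (h.1.trans h'.1.symm)
    (show 1 * v.prodFrom m = 1 * v'.prodFrom m by rw [h.2, h'.2])

theorem dualVec_comp_lift {m n : ℕ} {q : R.Idx k m} {p : R.Idx k n} {v : R.Idx k (m + n)}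
    (h : Idx.IsConcat q p v) : R.dualVec k p ∘ₗ R.lift k q n = R.dualVec k v := by
  classical
  refine R.functional_ext k fun u => ?_
  refine (R.dualVec_lift_single k q p u).trans ?_
  rw [← functional_single_eq_dualVec]
  refine Eq.trans ?_ (R.functional_single k _ u 1).symm
  show _ = R.aug k 1 * (Pi.single v (1 : k) : R.Idx k (m + n) → k) u
  rw [map_one, one_mul]
  by_cases hu : u = v
  · subst hu
    rw [if_pos h, Pi.single_eq_same]
  · rw [if_neg fun hc => hu (Idx.IsConcat.unique R k hc h), Pi.single_eq_of_ne hu]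

theorem dualVec_comp_lift_eq_zero {m n : ℕ} {q : R.Idx k m} {p : R.Idx k n}
    (h : ∀ v : R.Idx k (m + n), ¬ Idx.IsConcat q p v) :
    R.dualVec k p ∘ₗ R.lift k q n = 0 := by
  classical
  refine R.functional_ext k fun u => ?_
  refine (R.dualVec_lift_single k q p u).trans ?_
  exact if_neg (h u)

/-- From here on only the fact that the sign is a nonzero scalar matters. -/
theorem extClass_units_smul {j : ℕ} (ε : ℤˣ)
    (f : (R.Idx k j →₀ R.Alg k) →ₗ[R.Alg k] R.TrivCarrier k) :
    ∃ c : k, c ≠ 0 ∧ R.extClass k (ε • f) = c • R.extClass k f := by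
  rcases Int.units_eq_one_or ε with rfl | rfl
  · exact ⟨1, one_ne_zero, by rw [one_smul, one_smul]⟩
  · refine ⟨-1, neg_ne_zero.2 one_ne_zero, ?_⟩
    rw [Units.neg_smul, one_smul, neg_smul, one_smul]
    exact ((R.res k).neg_extMk (n := j) (ModuleCat.ofHom f) _ rfl (R.d_comp_ofHom k f)).symm

theorem of_comp_eq {a b c c' : ℕ} (α : Ext.{u} (R.triv k) (R.triv k) a)
    (β : Ext.{u} (R.triv k) (R.triv k) b) (h : a + b = c) (h' : a + b = c') :
    DirectSum.of (fun n : ℕ => Ext.{u} (R.triv k) (R.triv k) n) c (α.comp β h) =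
      DirectSum.of (fun n : ℕ => Ext.{u} (R.triv k) (R.triv k) n) c' (α.comp β h') := by
  subst h; subst h'; rfl

theorem yonedaBasis_mul {m n : ℕ} (q : R.Idx k m) (p : R.Idx k n) :
    R.yonedaBasis k ⟨n, p⟩ * R.yonedaBasis k ⟨m, q⟩ =
      DirectSum.of (fun n : ℕ => Ext.{u} (R.triv k) (R.triv k) n) (m + n)
        (R.extClass k (((m : ℤ) * n).negOnePow • (R.dualVec k p ∘ₗ R.lift k q n))) := by
  rw [yonedaBasis_apply, yonedaBasis_apply, DirectSum.of_mul_of, ← extClass_dualVec_comp]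
  exact R.of_comp_eq k _ _ _ _

theorem of_smul_ext {j : ℕ} (c : k) (α : Ext.{u} (R.triv k) (R.triv k) j) :
    DirectSum.of (fun n : ℕ => Ext.{u} (R.triv k) (R.triv k) n) j (c • α) =
      c • DirectSum.of (fun n : ℕ => Ext.{u} (R.triv k) (R.triv k) n) j α :=
  (DirectSum.lof k ℕ (fun n : ℕ => Ext.{u} (R.triv k) (R.triv k) n) j).map_smul c α

theorem yonedaBasis_mul_of_isConcat {m n : ℕ} {q : R.Idx k m} {p : R.Idx k n}
    {v : R.Idx k (m + n)} (h : Idx.IsConcat q p v) :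
    ∃ c : k, c ≠ 0 ∧ R.yonedaBasis k ⟨n, p⟩ * R.yonedaBasis k ⟨m, q⟩ =
      c • R.yonedaBasis k ⟨m + n, v⟩ := by
  obtain ⟨c, hc, h'⟩ := R.extClass_units_smul k ((m : ℤ) * n).negOnePow (R.dualVec k v)
  refine ⟨c, hc, ?_⟩
  rw [yonedaBasis_mul, R.dualVec_comp_lift k h, h', of_smul_ext, yonedaBasis_apply]

theorem yonedaBasis_mul_eq_zero {m n : ℕ} {q : R.Idx k m} {p : R.Idx k n}
    (h : ∀ v : R.Idx k (m + n), ¬ Idx.IsConcat q p v) :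
    R.yonedaBasis k ⟨n, p⟩ * R.yonedaBasis k ⟨m, q⟩ = 0 := by
  obtain ⟨c, hc, h'⟩ := R.extClass_units_smul k (j := m + n) ((m : ℤ) * n).negOnePow 0
  have h0 : R.extClass k (0 : (R.Idx k (m + n) →₀ R.Alg k) →ₗ[R.Alg k] R.TrivCarrier k) = 0 :=
    (R.res k).extMk_zero _ rfl
  rw [yonedaBasis_mul, R.dualVec_comp_lift_eq_zero k h, h', h0, smul_zero, map_zero]

theorem yonedaBasis_nil : R.yonedaBasis k ⟨0, Idx.nil R k⟩ = 1 := by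
  rw [yonedaBasis_apply, extClass_dualVec_nil]
  rfl

theorem yonedaBasis_eq_epsE (w : List (Mon s)) (hw : R.IsAnchored k w) :
    R.yonedaBasis k ⟨w.length, w, rfl, Or.inr hw⟩ = R.epsE k w hw :=
  R.yonedaBasis_apply k _

end Product

/-! ### Subalgebras generated by basis vectors. -/

section Words

/-- A walk is a concatenation if it is a nonempty walk followed by an admissible walk. -/
def IsSplit (l : List (Mon s)) : Prop :=
  ∃ q p : List (Mon s), q ≠ [] ∧ R.IsAdmissible k p ∧ l = q ++ p

theorem sigma_idx_ext {v v' : Σ j, R.Idx k j} (h : v.2.1 = v'.2.1) : v = v' := by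
  obtain ⟨j, v, rfl, hv⟩ := v
  obtain ⟨j', v', rfl, hv'⟩ := v'
  dsimp only at h
  subst h
  rfl

theorem yonedaBasis_eq_one {v : Σ j, R.Idx k j} (h : v.2.1 = []) : R.yonedaBasis k v = 1 := by
  rw [← yonedaBasis_nil]
  exact congrArg _ (R.sigma_idx_ext k h)

/-- The tail of `v` is a walk, though not necessarily anchored; the anchored walk `p` witnesses that
it is admissible. -/
theorem isSplit_of_isConcat {m n : ℕ} {q : R.Idx k m} {p : R.Idx k n} {v : R.Idx k (m + n)}
    (h : Idx.IsConcat q p v) (hq : q.1 ≠ []) (hp : p.1 ≠ []) : R.IsSplit k v.1 := by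
  have hn : n ≠ 0 := fun h0 => hp (List.length_eq_zero_iff.1 (p.2.1.trans h0))
  have hlen : (v.1.drop m).length = n := by rw [List.length_drop, v.2.1]; omega
  have hv : R.IsAnchored k v.1 := v.2.2.resolve_left fun h0 => by
    have := v.2.1
    rw [h0, List.length_nil] at this
    omega
  refine ⟨q.1, v.1.drop m, hq, ⟨⟨?_, ?_, ?_⟩, p.1, p.2.2.resolve_left hp, ?_, ?_⟩, ?_⟩
  · intro h0
    rw [h0, List.length_nil] at hlen
    exact hn hlen.symm
  · exact fun x hx => hv.1.2.1 x (List.mem_of_mem_drop hx)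
  · exact hv.1.2.2.drop m
  · rw [hlen, p.2.1]
  · simpa [Idx.prodFrom] using h.2
  · rw [← h.1, List.take_append_drop]

/-- Multiplying on the left by one more generator changes nothing if that generator is 1, gives the
generator itself up to a scalar if the rest is 1, and otherwise gives 0 or a concatenation. -/
theorem mem_closure_yonedaBasis (T : Set (Σ j, R.Idx k j)) {x : R.YonedaAlgebra k}
    (hx : x ∈ Submonoid.closure (R.yonedaBasis k '' T)) :
    x = 0 ∨ ∃ (c : k) (v : Σ j, R.Idx k j), c ≠ 0 ∧ x = c • R.yonedaBasis k v ∧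
      (v.2.1 = [] ∨ v ∈ T ∨ R.IsSplit k v.2.1) := by
  induction hx using Submonoid.closure_induction_left with
  | one =>
    refine Or.inr ⟨1, ⟨0, Idx.nil R k⟩, one_ne_zero, ?_, Or.inl rfl⟩
    rw [one_smul, yonedaBasis_nil]
  | mul_left x hx y hy ih =>
    obtain ⟨⟨n, p⟩, hp, rfl⟩ := hx
    rcases ih with rfl | ⟨c, ⟨m, q⟩, hc, rfl, hq⟩
    · exact Or.inl (mul_zero _)
    by_cases hq0 : q.1 = []
    · refine Or.inr ⟨c, ⟨n, p⟩, hc, ?_, Or.inr (Or.inl hp)⟩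
      rw [R.yonedaBasis_eq_one k (v := ⟨m, q⟩) hq0, mul_smul_comm, mul_one]
    by_cases hp0 : p.1 = []
    · refine Or.inr ⟨c, ⟨m, q⟩, hc, ?_, hq⟩
      rw [R.yonedaBasis_eq_one k (v := ⟨n, p⟩) hp0, one_mul]
    by_cases h : ∃ v : R.Idx k (m + n), Idx.IsConcat q p v
    · obtain ⟨v, hv⟩ := h
      obtain ⟨c', hc', h'⟩ := R.yonedaBasis_mul_of_isConcat k hv
      refine Or.inr ⟨c * c', ⟨m + n, v⟩, mul_ne_zero hc hc', ?_,
        Or.inr (Or.inr (R.isSplit_of_isConcat k hv hq0 hp0))⟩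
      rw [mul_smul_comm, h', smul_smul]
    · left
      rw [mul_smul_comm, R.yonedaBasis_mul_eq_zero k (not_exists.1 h), smul_zero]

/-- The subalgebra lies in the span of the allowed basis vectors, and by linear independence a basis
vector in that span is one of them. -/
theorem of_yonedaBasis_mem_adjoin (T : Set (Σ j, R.Idx k j)) (v : Σ j, R.Idx k j)
    (h : R.yonedaBasis k v ∈ Algebra.adjoin k (R.yonedaBasis k '' T)) :
    v.2.1 = [] ∨ v ∈ T ∨ R.IsSplit k v.2.1 := by
  rw [← Subalgebra.mem_toSubmodule, Algebra.adjoin_eq_span] at h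
  have hle : Submodule.span k (Submonoid.closure (R.yonedaBasis k '' T) : Set (R.YonedaAlgebra k)) ≤
      Submodule.span k (R.yonedaBasis k '' {v | v.2.1 = [] ∨ v ∈ T ∨ R.IsSplit k v.2.1}) := by
    refine Submodule.span_le.2 fun x hx => ?_
    rcases R.mem_closure_yonedaBasis k T hx with rfl | ⟨c, v, -, rfl, hv⟩
    · exact Submodule.zero_mem _
    · exact Submodule.smul_mem _ _ (Submodule.subset_span ⟨v, hv, rfl⟩)
  have := (R.yonedaBasis k).mem_span_image.1 (hle h)
  rw [Module.Basis.repr_self, Finsupp.support_single _ one_ne_zero] at this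
  exact this (Finset.mem_coe.2 (Finset.mem_singleton_self v))

end Words

end MonomialRelations
end MonomialYoneda

namespace MonomialYoneda
universe u

/-! ### Kernels of maps that send words to multiples of basis vectors. -/

section MonomialKernel

variable {k : Type u} [Field k] {G E ι : Type*} [Ring E] [Algebra k E]

theorem apply_eq_linearCombination (F : MonoidAlgebra k (FreeMonoid G) →ₐ[k] E)
    (f : MonoidAlgebra k (FreeMonoid G)) :
    F f = Finsupp.linearCombination k (fun m => F (MonoidAlgebra.of k _ m)) f.coeff := by
  induction f using MonoidAlgebra.induction_linear with
  | zero => simp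
  | add f g hf hg => rw [map_add, hf, hg, MonoidAlgebra.coeff_add, map_add]
  | single m c =>
    have hc : MonoidAlgebra.single m c = c • MonoidAlgebra.of k (FreeMonoid G) m := by
      simp [MonoidAlgebra.of_apply]
    rw [MonoidAlgebra.coeff_single, Finsupp.linearCombination_single, ← map_smul, ← hc]

/-- If an algebra map from a free algebra sends every word to zero or to a multiple of a basis
vector, then its kernel is generated by monomials and binomials. -/
theorem ker_eq_span_monomials_binomials (b : Module.Basis ι k E)
    (F : MonoidAlgebra k (FreeMonoid G) →ₐ[k] E)
    (hF : ∀ m, F (MonoidAlgebra.of k _ m) = 0 ∨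
      ∃ (c : k) (i : ι), c ≠ 0 ∧ F (MonoidAlgebra.of k _ m) = c • b i) :
    TwoSidedIdeal.ker F =
      TwoSidedIdeal.span {f | F f = 0 ∧ (IsMonomial f ∨ IsBinomial f)} := by
  classical
  refine le_antisymm (fun f hf => ?_)
    (TwoSidedIdeal.span_le.2 fun f hf => (TwoSidedIdeal.mem_ker _).2 hf.1)
  replace hf : F f = 0 := (TwoSidedIdeal.mem_ker _).1 hf
  set J := TwoSidedIdeal.span {f | F f = 0 ∧ (IsMonomial f ∨ IsBinomial f)}
  have hsmul : ∀ (a : k) (g : MonoidAlgebra k (FreeMonoid G)), g ∈ J → a • g ∈ J := by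
    intro a g hg
    rw [Algebra.smul_def]
    exact TwoSidedIdeal.mul_mem_left _ _ _ hg
  induction hn : f.coeff.support.card using Nat.strong_induction_on generalizing f with
  | _ n ih =>
    -- Subtracting an element of `J` that agrees with `f` at `m` and has no new support shortens
    -- `f`, so the induction on the size of the support applies.
    have step : ∀ m ∈ f.coeff.support, ∀ g ∈ J, F g = 0 → g.coeff m = f.coeff m →
        g.coeff.support ⊆ f.coeff.support → f ∈ J := by
      intro m hm g hgJ hg hgm hsub
      have hlt : (f - g).coeff.support.card < n := by
        rw [← hn]
        refine Finset.card_lt_card ((Finset.ssubset_iff_of_subset fun x hx => ?_).2 ⟨m, hm, ?_⟩)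
        · by_contra hx'
          have h1 : f.coeff x = 0 := Finsupp.notMem_support_iff.1 hx'
          have h2 : g.coeff x = 0 := Finsupp.notMem_support_iff.1 fun h => hx' (hsub h)
          exact Finsupp.mem_support_iff.1 hx (by simp [h1, h2])
        · simp [hgm]
      have := ih _ hlt (f - g) (by rw [map_sub, hf, hg, sub_zero]) rfl
      have := TwoSidedIdeal.add_mem _ this hgJ
      rwa [sub_add_cancel] at this
    rcases eq_or_ne f 0 with rfl | hf0
    · exact TwoSidedIdeal.zero_mem _
    obtain ⟨m, hm⟩ : f.coeff.support.Nonempty := by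
      rw [Finsupp.support_nonempty_iff]
      exact fun h => hf0 (MonoidAlgebra.coeff_injective (h.trans MonoidAlgebra.coeff_zero.symm))
    rcases hF m with h0 | ⟨c, i, hc, hci⟩
    · refine step m hm (f.coeff m • MonoidAlgebra.of k _ m)
        (hsmul _ _ (TwoSidedIdeal.subset_span ⟨h0, Or.inl ⟨m, rfl⟩⟩)) ?_ ?_ ?_
      · rw [map_smul, h0, smul_zero]
      · simp [MonoidAlgebra.of_apply]
      · intro x hx
        by_contra hx'
        have hxm : x ≠ m := fun h => hx' (h ▸ hm)
        simp [MonoidAlgebra.of_apply, hxm] at hx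
    -- Without a second word on the line of `b i`, the coefficient of `b i` in `F f = 0` would be
    -- `f.coeff m * c`, which is nonzero.
    · obtain ⟨m', hm', hne, c', hc', hci'⟩ : ∃ m' ∈ f.coeff.support, m' ≠ m ∧ ∃ c' : k, c' ≠ 0 ∧
          F (MonoidAlgebra.of k _ m') = c' • b i := by
        by_contra hcon
        push Not at hcon
        have h := congrArg (fun x => b.repr x i) ((apply_eq_linearCombination F f).symm.trans hf)
        simp only [Finsupp.linearCombination_apply, Finsupp.sum, map_sum, map_smul, map_zero,
          Finsupp.coe_finsetSum, Finset.sum_apply, Finsupp.coe_zero, Pi.zero_apply,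
          Finsupp.smul_apply, smul_eq_mul] at h
        rw [Finset.sum_eq_single m] at h
        · rw [hci, map_smul, Module.Basis.repr_self, Finsupp.smul_apply, Finsupp.single_eq_same,
            smul_eq_mul, mul_one] at h
          exact mul_ne_zero (Finsupp.mem_support_iff.1 hm) hc h
        · intro x hx hxm
          rcases hF x with h0 | ⟨d, i', hd, hdi⟩
          · rw [h0]; simp
          · have hii : i' ≠ i := by
              rintro rfl
              exact hcon x hx hxm d hd hdi
            rw [hdi, map_smul, Module.Basis.repr_self, Finsupp.smul_apply,
              Finsupp.single_eq_of_ne' hii, smul_zero, mul_zero]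
        · exact fun h' => absurd hm h'
      have hker : F (c' • MonoidAlgebra.of k _ m + (-c) • MonoidAlgebra.of k _ m') = 0 := by
        rw [map_add, map_smul, map_smul, hci, hci', smul_smul, smul_smul, ← add_smul]
        ring_nf
        exact zero_smul _ _
      refine step m hm ((f.coeff m * c'⁻¹) •
        (c' • MonoidAlgebra.of k _ m + (-c) • MonoidAlgebra.of k _ m'))
        (hsmul _ _ (TwoSidedIdeal.subset_span
          ⟨hker, Or.inr ⟨m, m', hne.symm, c', -c, hc', neg_ne_zero.2 hc, rfl⟩⟩)) ?_ ?_ ?_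
      · rw [map_smul, hker, smul_zero]
      · simp [MonoidAlgebra.of_apply, hne, hc']
      · intro x hx
        by_contra hx'
        have hxm : x ≠ m := fun h => hx' (h ▸ hm)
        have hxm' : x ≠ m' := fun h => hx' (h ▸ hm')
        simp [MonoidAlgebra.of_apply, hxm, hxm'] at hx

end MonomialKernel

/-! ### Decomposable classes and the presentation of E(A). -/

namespace MonomialRelations

variable {s : ℕ} (R : MonomialRelations s) (k : Type u) [Field k]

variable {R k} in
theorem IsIndex.of_append {q p : List (Mon s)} (h : R.IsIndex k (q ++ p)) : R.IsIndex k q := by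
  induction p using List.reverseRecOn with
  | nil => simpa using h
  | append_singleton p m ih =>
    rw [← List.append_assoc] at h
    exact ih ((R.isIndex_append_iff k _ m).1 h).1

/-- The admissible tail need not index a basis vector, so it is replaced by the anchored walk
equivalent to it, which has the same length and product. -/
theorem exists_mul_of_isSplit (v : Σ j, R.Idx k j) (h : R.IsSplit k v.2.1) :
    ∃ (p q : Σ j, R.Idx k j) (c : k), c ≠ 0 ∧ p.1 < v.1 ∧ q.1 < v.1 ∧
      R.yonedaBasis k p * R.yonedaBasis k q = c • R.yonedaBasis k v := by
  obtain ⟨q, p, hq0, ⟨hp, p', hp', hlen, hprod⟩, hv⟩ := h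
  have hq : R.IsIndex k q := IsIndex.of_append (hv ▸ v.2.2.2)
  have hv1 : v.1 = q.length + p'.length := by
    rw [← v.2.2.1, hv, List.length_append, hlen]
  have hqpos := List.length_pos_iff.2 hq0
  have hppos := List.length_pos_iff.2 hp'.1.1
  let q₁ : R.Idx k q.length := ⟨q, rfl, hq⟩
  let p₁ : R.Idx k p'.length := ⟨p', rfl, Or.inr hp'⟩
  let v₁ : R.Idx k (q.length + p'.length) := ⟨v.2.1, v.2.2.1.trans hv1, v.2.2.2⟩
  have hc : Idx.IsConcat q₁ p₁ v₁ := by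
    constructor
    · show v.2.1.take q.length = q
      rw [hv, List.take_left]
    · show (v.2.1.drop q.length).reverse.prod = (p'.drop 0).reverse.prod
      rw [hv, List.drop_left, List.drop_zero, hprod]
  obtain ⟨c, hc0, h⟩ := R.yonedaBasis_mul_of_isConcat k hc
  refine ⟨⟨_, p₁⟩, ⟨_, q₁⟩, c, hc0, by dsimp only; omega, by dsimp only; omega, ?_⟩
  rw [h]
  exact congrArg (fun v => c • R.yonedaBasis k v) (R.sigma_idx_ext k rfl)

/-- Classes of lower degree are combinations of basis vectors indexed by shorter walks. Neither the
empty walk nor a shorter one can be `w`, so only concatenations remain. -/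
theorem isDecomposable_iff_isSplit (w : List (Mon s)) (hw : R.IsAnchored k w) :
    IsDecomposable k (R.eps k w hw) ↔ R.IsSplit k w := by
  have hb := R.yonedaBasis_eq_epsE k w hw
  have hdec : IsDecomposable k (R.eps k w hw) ↔
      R.yonedaBasis k ⟨w.length, w, rfl, Or.inr hw⟩ ∈ Algebra.adjoin k
        {x : R.YonedaAlgebra k | ∃ j < w.length, ∃ β : Ext.{u} (R.triv k) (R.triv k) j,
          x = DirectSum.of (fun n : ℕ => Ext.{u} (R.triv k) (R.triv k) n) j β} := by
    rw [hb]; rfl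
  rw [hdec]
  constructor
  · intro h
    have hle : Algebra.adjoin k
        {x : R.YonedaAlgebra k | ∃ j < w.length, ∃ β : Ext.{u} (R.triv k) (R.triv k) j,
          x = DirectSum.of (fun n : ℕ => Ext.{u} (R.triv k) (R.triv k) n) j β} ≤
        Algebra.adjoin k (R.yonedaBasis k '' {v | v.1 < w.length}) := by
      refine Algebra.adjoin_le ?_
      rintro _ ⟨j, hj, β, rfl⟩
      have hβ : β ∈ Submodule.span k (Set.range (R.extBasis k j)) := by
        rw [Module.Basis.span_eq]; trivial
      induction hβ using Submodule.span_induction with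
      | mem x hx =>
        obtain ⟨v, rfl⟩ := hx
        rw [extBasis_apply, ← yonedaBasis_apply]
        exact Algebra.subset_adjoin ⟨⟨j, v⟩, hj, rfl⟩
      | zero => rw [map_zero]; exact Subalgebra.zero_mem _
      | add x y _ _ hx hy => rw [map_add]; exact Subalgebra.add_mem _ hx hy
      | smul c x _ hx => rw [of_smul_ext]; exact Subalgebra.smul_mem _ hx c
    rcases R.of_yonedaBasis_mem_adjoin k _ _ (hle h) with h | h | h
    · exact absurd h hw.1.1
    · exact absurd h (lt_irrefl w.length)
    · exact h
  · intro h
    obtain ⟨p, q, c, hc, hp, hq, hpq⟩ :=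
      R.exists_mul_of_isSplit k ⟨w.length, w, rfl, Or.inr hw⟩ h
    rw [← inv_smul_smul₀ hc (R.yonedaBasis k ⟨w.length, w, rfl, Or.inr hw⟩), ← hpq]
    refine Subalgebra.smul_mem _ (Subalgebra.mul_mem _ (Algebra.subset_adjoin ?_)
      (Algebra.subset_adjoin ?_)) _
    · exact ⟨p.1, hp, _, R.yonedaBasis_apply k p.2⟩
    · exact ⟨q.1, hq, _, R.yonedaBasis_apply k q.2⟩

theorem isSplit_iff {n : ℕ} {w : List (Mon s)} (hn : w.length = n + 1) :
    R.IsSplit k w ↔ ∃ p, R.IsAdmissible k p ∧ ∃ i < n, w = w.take (i + 1) ++ p := by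
  constructor
  · rintro ⟨q, p, hq, hp, rfl⟩
    have h1 := List.length_pos_iff.2 hq
    have h2 := List.length_pos_iff.2 hp.1.1
    rw [List.length_append] at hn
    -- The index `i` is that of the last vertex of `q`, whence `i + 1` vertices; `i < n` because `p`
    -- is nonempty.
    refine ⟨p, hp, q.length - 1, by omega, ?_⟩
    rw [show q.length - 1 + 1 = q.length by omega, List.take_left]
  · rintro ⟨p, hp, i, hi, h⟩
    refine ⟨_, p, ?_, hp, h⟩
    intro h0
    have := congrArg List.length h0
    rw [List.length_take, List.length_nil] at this
    omega

/-- The index of an indecomposable walk. -/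
def IndecWalk.idx (w : R.IndecWalk k) : Σ j, R.Idx k j :=
  ⟨w.1.length, w.1, rfl, Or.inr w.2.choose⟩

theorem presentation_of (w : R.IndecWalk k) :
    R.presentation k (MonoidAlgebra.of k _ (FreeMonoid.of w)) =
      R.yonedaBasis k (IndecWalk.idx R k w) := by
  rw [presentation, MonoidAlgebra.lift_of, FreeMonoid.lift_eval_of]
  exact (R.yonedaBasis_eq_epsE k _ _).symm

/-- Induction on the degree: a walk that splits gives a product of two classes of lower degree up to
a nonzero scalar, and any other nonempty one is a generator. -/
theorem yonedaBasis_mem_range (n : ℕ) (v : Σ j, R.Idx k j) (hv : v.1 = n) :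
    R.yonedaBasis k v ∈ (R.presentation k).range := by
  induction n using Nat.strong_induction_on generalizing v with
  | _ n ih =>
    by_cases h0 : v.2.1 = []
    · rw [R.yonedaBasis_eq_one k h0]
      exact Subalgebra.one_mem _
    have hw := v.2.2.2.resolve_left h0
    by_cases hs : R.IsSplit k v.2.1
    · obtain ⟨p, q, c, hc, hp, hq, hpq⟩ := R.exists_mul_of_isSplit k v hs
      rw [← inv_smul_smul₀ hc (R.yonedaBasis k v), ← hpq]
      exact Subalgebra.smul_mem _ (Subalgebra.mul_mem _ (ih _ (hv ▸ hp) p rfl)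
        (ih _ (hv ▸ hq) q rfl)) _
    · let w : R.IndecWalk k := ⟨v.2.1, hw, fun h => hs ((R.isDecomposable_iff_isSplit k _ hw).1 h)⟩
      refine ⟨MonoidAlgebra.of k _ (FreeMonoid.of w), ?_⟩
      refine (R.presentation_of k w).trans ?_
      exact congrArg _ (R.sigma_idx_ext k rfl)

theorem presentation_surjective : Function.Surjective (R.presentation k) := by
  intro x
  have hx : x ∈ Submodule.span k (Set.range (R.yonedaBasis k)) := by
    rw [Module.Basis.span_eq]; trivial
  have hle : Submodule.span k (Set.range (R.yonedaBasis k)) ≤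
      Subalgebra.toSubmodule (R.presentation k).range := by
    refine Submodule.span_le.2 ?_
    rintro _ ⟨v, rfl⟩
    exact R.yonedaBasis_mem_range k _ v rfl
  exact hle hx

theorem presentation_of_notMem (w : R.IndecWalk k) :
    R.presentation k (MonoidAlgebra.of k _ (FreeMonoid.of w)) ∉
      Algebra.adjoin k {x | ∃ v : R.IndecWalk k, v ≠ w ∧
        x = R.presentation k (MonoidAlgebra.of k _ (FreeMonoid.of v))} := by
  intro h
  have hset : {x | ∃ v : R.IndecWalk k, v ≠ w ∧
      x = R.presentation k (MonoidAlgebra.of k _ (FreeMonoid.of v))} =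
      R.yonedaBasis k '' (IndecWalk.idx R k '' {v | v ≠ w}) := by
    rw [← Set.image_comp]
    ext x
    constructor
    · rintro ⟨v, hv, rfl⟩
      exact ⟨v, hv, (R.presentation_of k v).symm⟩
    · rintro ⟨v, hv, rfl⟩
      exact ⟨v, hv, (R.presentation_of k v).symm⟩
  rw [presentation_of, hset] at h
  obtain ⟨hw, hdec⟩ := w.2
  rcases R.of_yonedaBasis_mem_adjoin k _ _ h with h | ⟨v, hv, h⟩ | h
  · exact hw.1.1 h
  · exact hv (Subtype.ext (congrArg (fun v : Σ j, R.Idx k j => v.2.1) h))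
  · exact hdec ((R.isDecomposable_iff_isSplit k _ hw).2 h)

theorem presentation_word (m : FreeMonoid (R.IndecWalk k)) :
    R.presentation k (MonoidAlgebra.of k _ m) = 0 ∨ ∃ (c : k) (v : Σ j, R.Idx k j), c ≠ 0 ∧
      R.presentation k (MonoidAlgebra.of k _ m) = c • R.yonedaBasis k v := by
  have h : R.presentation k (MonoidAlgebra.of k _ m) ∈
      Submonoid.closure (R.yonedaBasis k '' Set.univ) := by
    induction m using FreeMonoid.inductionOn with
    | one => rw [map_one, map_one]; exact Submonoid.one_mem _
    | of w => rw [presentation_of]; exact Submonoid.subset_closure ⟨_, trivial, rfl⟩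
    | mul x y hx hy => rw [map_mul, map_mul]; exact Submonoid.mul_mem _ hx hy
  rcases R.mem_closure_yonedaBasis k _ h with h | ⟨c, v, hc, h, -⟩
  · exact Or.inl h
  · exact Or.inr ⟨c, v, hc, h⟩

end MonomialRelations
end MonomialYoneda

theorem corollary3p3 {k : Type*} [Field k] {s : ℕ} (R : MonomialYoneda.MonomialRelations s) :
    (∀ (n : ℕ) (w : List (MonomialYoneda.Mon s)) (hw : R.IsAnchored k w), w.length = n + 1 →
      (MonomialYoneda.IsDecomposable k (R.eps k w hw) ↔
        ∃ p : List (MonomialYoneda.Mon s), R.IsAdmissible k p ∧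
          ∃ i < n, w = w.take (i + 1) ++ p)) ∧
    (Function.Surjective (R.presentation k) ∧
      (∀ w : R.IndecWalk k, R.presentation k (MonoidAlgebra.of k _ (FreeMonoid.of w)) ∉
        Algebra.adjoin k {x | ∃ v : R.IndecWalk k, v ≠ w ∧
          x = R.presentation k (MonoidAlgebra.of k _ (FreeMonoid.of v))}) ∧
      ∃ S : Set (MonoidAlgebra k (FreeMonoid (R.IndecWalk k))),
        (∀ f ∈ S, MonomialYoneda.IsMonomial f ∨ MonomialYoneda.IsBinomial f) ∧
        TwoSidedIdeal.ker (R.presentation k) = TwoSidedIdeal.span S) := by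

  -- The generating set left to unification consists of all monomials and binomials in the kernel.
  refine ⟨fun n w hw hn => (R.isDecomposable_iff_isSplit k w hw).trans (R.isSplit_iff k hn),
    R.presentation_surjective k, R.presentation_of_notMem k, _, fun f hf => hf.2,
    MonomialYoneda.ker_eq_span_monomials_binomials (R.yonedaBasis k) (R.presentation k)
      (R.presentation_word k)⟩
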